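/- Let $d\ge 1$ be an integer and let $T$ be the homogeneous tree of degree $d$ (the tree in which every vertex has exactly $d$ neighbours). Let $(a_e)_{e\in E(T)}$ be identically distributed real random variables indexed by the undirected edges and $(b_v)_{v\in V(T)}$ identically distributed real random variables indexed by the vertices, such that all the $a_e$ and $b_v$ together are independent and both distributions have bounded support. Let $H=H_\omega$ be the random (almost surely bounded, self-adjoint) Jacobi operator on $\ell^2(V(T))$, $$(H\psi)(u)=b_u\psi(u)+\sum_{v\sim u}a_{uv}\psi(v).$$ For a vertex $u$ and $z\in\mathbb C_+=\{\operatorname{Im}z>0\}$ put $G_u(z)=\langle\delta_u,(H-z)^{-1}\delta_u\rangle$. For a directed edge $e$ with head $\tau(e)$, let $T_e^+$ be the connected component containing $\tau(e)$ of the graph obtained from $T$ by removing $e$, let $H_e^+$ be the Jacobi operator on $\ell^2(V(T_e^+))$ with the restricted parameters, and put $m_e(z)=\langle\delta_{\tau(e)},(H_e^+-z)^{-1}\delta_{\tau(e)}\rangle$. Let $\mu_o^{\omega}$ be the spectral measure of $H_\omega$ and $\delta_o$, and let the density of states be the expected spectral measure $dk=\mathbb E\,d\mu_o^\omega$. Then,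 for every vertex $o$ used in the definition of $dk$, every vertex $u$, every directed edge $e$ and every $z\in\mathbb C_+$ (with $\log$ the principal branch throughout), $\omega\mapsto\mu_o^\omega$ is almost everywhere measurable, $dk$ is a probability measure, $\log(t-z)$ is $dk$-integrable, $\log G_u(z)$ and $\log m_e(z)$ have finite expectation, and $$\int\log(t-z)\,dk(t)=\Bigl(\frac d2-1\Bigr)\,\mathbb E\bigl(\log G_u(z)\bigr)-\frac d2\,\mathbb E\bigl(\log m_e(z)\bigr).$$ In particular, for $d=2$, $\int\log(t-z)\,dk(t)=-\mathbb E(\log m_e(z))$. -/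

import Mathlib

open MeasureTheory ProbabilityTheory

noncomputable section

/-- The Hilbert space `ℓ²(V)` of square-summable complex functions on a vertex set. -/
abbrev EllTwo (V : Type*) : Type _ := lp (fun _ : V => ℂ) 2

/-- The unit vector `δ_u` of `ℓ²(V)`. -/
def deltaVec {V : Type*} (u : V) : EllTwo V :=
  letI := Classical.decEq V
  lp.single 2 u (1 : ℂ)

/-- The matrix action of the Jacobi matrix on the graph `G` with couplings `a` (on the edges) and
potential `b` (on the vertices): `(Hψ)(u) = b(u) ψ(u) + ∑_{v ~ u} a(uv) ψ(v)`. -/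
def jacobiAction {V : Type*} (G : SimpleGraph V) (a : G.edgeSet → ℝ) (b : V → ℝ)
    (ψ : V → ℂ) (u : V) : ℂ :=
  (b u : ℂ) * ψ u + ∑ᶠ v : G.neighborSet u, (a ⟨s(u, (v : V)), v.2⟩ : ℂ) * ψ v

/-- `T` is the bounded operator on `ℓ²(V)` whose matrix is the Jacobi matrix of `(a, b)`. -/
def IsJacobiOperator {V : Type*} (G : SimpleGraph V) (a : G.edgeSet → ℝ) (b : V → ℝ)
    (T : EllTwo V →L[ℂ] EllTwo V) : Prop :=
  ∀ (ψ : EllTwo V) (u : V), T ψ u = jacobiAction G a b ψ u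

/-- There is at most one bounded operator with a given Jacobi matrix. -/
theorem IsJacobiOperator.unique {V : Type*} {G : SimpleGraph V} {a : G.edgeSet → ℝ} {b : V → ℝ}
    {S T : EllTwo V →L[ℂ] EllTwo V} (hS : IsJacobiOperator G a b S)
    (hT : IsJacobiOperator G a b T) : S = T := by
  ext ψ u
  rw [hS, hT]

open Classical in
/-- The Jacobi operator on `ℓ²(V)`. It exists (and is then unique) for bounded parameters on a graph
of bounded degree, see `exists_isJacobiOperator`; if there is no such bounded operator, the value
is the default `0`. -/
def jacobiOperator {V : Type*} (G : SimpleGraph V) (a : G.edgeSet → ℝ) (b : V → ℝ) :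
    EllTwo V →L[ℂ] EllTwo V :=
  if h : ∃ T, IsJacobiOperator G a b T then h.choose else 0

theorem exists_isJacobiOperator {V : Type*} (G : SimpleGraph V) (a : G.edgeSet → ℝ) (b : V → ℝ)
    (D : ℕ) (hD : ∀ u, (G.neighborSet u).encard ≤ D) (C : ℝ) (hC : 0 ≤ C)
    (ha : ∀ e, |a e| ≤ C) (hb : ∀ u, |b u| ≤ C) :
    ∃ T, IsJacobiOperator G a b T := by
  classical
  have hfin : ∀ u, (G.neighborSet u).Finite := fun u =>
    Set.finite_of_encard_le_coe (hD u)
  let _ : ∀ u, Fintype (G.neighborSet u) := fun u => (hfin u).fintype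
  have hcard : ∀ u, (G.neighborFinset u).card ≤ D := by
    intro u
    have := hD u
    rw [← SimpleGraph.coe_neighborFinset, Set.encard_coe_eq_coe_finsetCard] at this
    exact_mod_cast this
  have hpt : ∀ (ψ : V → ℂ) (u : V), ‖jacobiAction G a b ψ u‖ ^ 2 ≤
      C ^ 2 * (D + 1) * (‖ψ u‖ ^ 2 + ∑ v ∈ G.neighborFinset u, ‖ψ v‖ ^ 2) := by
    intro ψ u
    have h1 : ‖jacobiAction G a b ψ u‖ ≤ C * (‖ψ u‖ + ∑ v ∈ G.neighborFinset u, ‖ψ v‖) := by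
      unfold jacobiAction
      rw [finsum_eq_sum_of_fintype, mul_add]
      refine (norm_add_le _ _).trans (add_le_add ?_ ?_)
      · rw [norm_mul, Complex.norm_real]
        exact mul_le_mul_of_nonneg_right (hb u) (norm_nonneg _)
      · rw [Finset.mul_sum]
        refine (norm_sum_le _ _).trans ?_
        have : ∑ v ∈ G.neighborFinset u, C * ‖ψ v‖ = ∑ v : G.neighborSet u, C * ‖ψ v‖ := by
          rw [SimpleGraph.neighborFinset, ← Finset.sum_coe_sort]
          exact Fintype.sum_equiv (Equiv.subtypeEquivRight (by simp)) _ _ (by simp)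
        rw [this]
        refine Finset.sum_le_sum fun v _ => ?_
        rw [norm_mul, Complex.norm_real]
        exact mul_le_mul_of_nonneg_right (ha _) (norm_nonneg _)
    have h2 : (‖ψ u‖ + ∑ v ∈ G.neighborFinset u, ‖ψ v‖) ^ 2 ≤
        (D + 1) * (‖ψ u‖ ^ 2 + ∑ v ∈ G.neighborFinset u, ‖ψ v‖ ^ 2) := by
      have hu : u ∉ G.neighborFinset u := by simp
      have := sq_sum_le_card_mul_sum_sq (s := insert u (G.neighborFinset u))
        (f := fun v => ‖ψ v‖)
      rw [Finset.sum_insert hu, Finset.sum_insert hu, Finset.card_insert_of_notMem hu] at this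
      refine this.trans (mul_le_mul_of_nonneg_right ?_ ?_)
      · have := hcard u
        exact_mod_cast Nat.succ_le_succ this
      · exact add_nonneg (sq_nonneg _) (Finset.sum_nonneg fun _ _ => sq_nonneg _)
    calc ‖jacobiAction G a b ψ u‖ ^ 2
        ≤ (C * (‖ψ u‖ + ∑ v ∈ G.neighborFinset u, ‖ψ v‖)) ^ 2 :=
          pow_le_pow_left₀ (norm_nonneg _) h1 2
      _ ≤ _ := by
          rw [mul_pow, mul_assoc]
          exact mul_le_mul_of_nonneg_left h2 (sq_nonneg _)
  have hsum : ∀ (ψ : EllTwo V) (s : Finset V),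
      ∑ u ∈ s, ‖jacobiAction G a b ψ u‖ ^ 2 ≤ (C * (D + 1) * ‖ψ‖) ^ 2 := by
    intro ψ s
    have hl : ∀ t : Finset V, ∑ u ∈ t, ‖ψ u‖ ^ 2 ≤ ‖ψ‖ ^ 2 := by
      intro t
      have := lp.sum_rpow_le_norm_rpow (p := 2) (by simp) ψ t
      simpa using this
    have hdc : ∑ u ∈ s, ∑ v ∈ G.neighborFinset u, ‖ψ v‖ ^ 2 ≤ D * ‖ψ‖ ^ 2 := by
      have h3 : ∑ u ∈ s, ∑ v ∈ G.neighborFinset u, ‖ψ v‖ ^ 2 =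
          ∑ v ∈ s.biUnion (fun u => G.neighborFinset u),
            ∑ _u ∈ s.filter (fun u => v ∈ G.neighborFinset u), ‖ψ v‖ ^ 2 := by
        refine Finset.sum_comm' ?_
        intro x y
        simp only [Finset.mem_filter, Finset.mem_biUnion]
        exact ⟨fun h => ⟨h, x, h⟩, fun h => h.1⟩
      rw [h3]
      calc _ ≤ ∑ v ∈ s.biUnion (fun u => G.neighborFinset u), (D : ℝ) * ‖ψ v‖ ^ 2 := by
            refine Finset.sum_le_sum fun v _ => ?_
            rw [Finset.sum_const, nsmul_eq_mul]
            refine mul_le_mul_of_nonneg_right ?_ (sq_nonneg _)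
            have : s.filter (fun u => v ∈ G.neighborFinset u) ⊆ G.neighborFinset v := by
              intro x hx
              simp only [Finset.mem_filter, SimpleGraph.mem_neighborFinset] at hx ⊢
              exact hx.2.symm
            exact_mod_cast (Finset.card_le_card this).trans (hcard v)
        _ ≤ _ := by
            rw [← Finset.mul_sum]
            exact mul_le_mul_of_nonneg_left (hl _) (Nat.cast_nonneg _)
    calc _ ≤ ∑ u ∈ s, C ^ 2 * (D + 1) *
            (‖ψ u‖ ^ 2 + ∑ v ∈ G.neighborFinset u, ‖ψ v‖ ^ 2) :=
          Finset.sum_le_sum fun u _ => hpt ψ u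
      _ = C ^ 2 * (D + 1) *
            (∑ u ∈ s, ‖ψ u‖ ^ 2 + ∑ u ∈ s, ∑ v ∈ G.neighborFinset u, ‖ψ v‖ ^ 2) := by
          rw [← Finset.mul_sum, Finset.sum_add_distrib]
      _ ≤ C ^ 2 * (D + 1) * (‖ψ‖ ^ 2 + D * ‖ψ‖ ^ 2) :=
          mul_le_mul_of_nonneg_left (add_le_add (hl s) hdc) (by positivity)
      _ = _ := by ring
  have hmem : ∀ ψ : EllTwo V, Memℓp (jacobiAction G a b ψ) 2 := fun ψ =>
    memℓp_gen' (C := (C * (D + 1) * ‖ψ‖) ^ 2) fun s => by simpa using hsum ψ s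
  let L : EllTwo V →ₗ[ℂ] EllTwo V :=
    { toFun := fun ψ => ⟨jacobiAction G a b ψ, hmem ψ⟩
      map_add' := by
        intro φ ψ
        ext u
        simp only [jacobiAction, finsum_eq_sum_of_fintype, lp.coeFn_add, Pi.add_apply, mul_add,
          Finset.sum_add_distrib]
        ring
      map_smul' := by
        intro c ψ
        ext u
        simp only [jacobiAction, finsum_eq_sum_of_fintype, lp.coeFn_smul, Pi.smul_apply,
          smul_eq_mul, RingHom.id_apply, mul_add, Finset.mul_sum]
        congr 1
        · ring
        · exact Finset.sum_congr rfl fun v _ => by ring }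
  refine ⟨L.mkContinuous (C * (D + 1)) fun ψ => ?_, fun ψ u => rfl⟩
  refine lp.norm_le_of_forall_sum_le (p := 2) (by simp) (by positivity) fun s => ?_
  simpa [L] using hsum ψ s

/-- The diagonal Green's function `⟨δ_u, (T - z)⁻¹ δ_u⟩`. -/
def greenFunction {V : Type*} (T : EllTwo V →L[ℂ] EllTwo V) (u : V) (z : ℂ) : ℂ :=
  inner ℂ (deltaVec u) (Ring.inverse (T - z • (1 : EllTwo V →L[ℂ] EllTwo V)) (deltaVec u))

/-- For a directed edge `e` of `G`, the vertices that are still connected to the head `τ(e)` of `e`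
after the edge `e` has been removed. -/
def forwardSet {V : Type*} (G : SimpleGraph V) (e : G.Dart) : Set V :=
  {v | (G.deleteEdges {e.edge}).Reachable e.snd v}

/-- The `m`-function of the directed edge `e`: the Green's function, at the head `τ(e)` of `e`, of
the Jacobi operator with restricted parameters on the part `T⁺_e` of the tree on the side of
`τ(e)`. -/
def mFunction {V : Type*} (G : SimpleGraph V) (a : G.edgeSet → ℝ) (b : V → ℝ) (e : G.Dart)
    (z : ℂ) : ℂ :=
  greenFunction
    (jacobiOperator (G.induce (forwardSet G e))
      (fun f => a ((SimpleGraph.Embedding.induce (forwardSet G e)).mapEdgeSet f))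
      (fun v => b v))
    (⟨e.snd, SimpleGraph.Reachable.refl e.snd⟩ : forwardSet G e) z

/-- For a bounded self-adjoint operator `T` and a vector `x`, the positive linear functional
`f ↦ ⟨x, f(T) x⟩` on the continuous functions on the spectrum of `T`, `f(T)` being given by the
continuous functional calculus. -/
def spectralFunctional {E : Type*} [NormedAddCommGroup E] [InnerProductSpace ℂ E]
    [CompleteSpace E] (T : E →L[ℂ] E) (hT : IsSelfAdjoint T)
    (x : E) :
    CompactlySupportedContinuousMap (spectrum ℝ T) ℝ →ₚ[ℝ] ℝ :=
  PositiveLinearMap.mk₀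
    { toFun := fun f => (inner ℂ x (cfcHom hT (R := ℝ) f.toContinuousMap x)).re
      map_add' := by
        intro f g
        have h : (f + g).toContinuousMap = f.toContinuousMap + g.toContinuousMap := rfl
        rw [h, map_add, add_apply, inner_add_right, Complex.add_re]
      map_smul' := by
        intro c f
        have h : (c • f).toContinuousMap = c • f.toContinuousMap := rfl
        rw [h, map_smul, smul_apply, ← Complex.coe_smul, inner_smul_right]
        simp }
    (by
      intro f hf
      have h : 0 ≤ cfcHom hT (R := ℝ) f.toContinuousMap :=
        (cfcHom_nonneg_iff hT).mpr fun t => hf t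
      rw [ContinuousLinearMap.nonneg_iff_isPositive] at h
      exact h.re_inner_nonneg_right x)

open Classical in
/-- The spectral measure on `ℝ` of a bounded self-adjoint operator `T` and a vector `x`: the Borel
measure, carried by the spectrum, that represents `f ↦ ⟨x, f(T) x⟩` by the Riesz–Markov–Kakutani
theorem (the default value is `0` if `T` is not self-adjoint). -/
def spectralMeasure {E : Type*} [NormedAddCommGroup E] [InnerProductSpace ℂ E]
    [CompleteSpace E] (T : E →L[ℂ] E) (x : E) : Measure ℝ :=
  if hT : IsSelfAdjoint T then
    have : CompactSpace (spectrum ℝ T) :=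
      isCompact_iff_compactSpace.mp (ContinuousFunctionalCalculus.isCompact_spectrum T)
    (RealRMK.rieszMeasure (spectralFunctional T hT x)).map Subtype.val
  else 0

/-- The Anderson Hamiltonian: the Jacobi operator with the realisation `ω` of the random
couplings `a` and the random potential `b`. -/
def andersonOperator {V Ω : Type*} (G : SimpleGraph V) (a : G.edgeSet → Ω → ℝ) (b : V → Ω → ℝ)
    (ω : Ω) : EllTwo V →L[ℂ] EllTwo V :=
  jacobiOperator G (fun e => a e ω) (fun v => b v ω)

/-- The density of states measure: the expectation of the spectral measure at the vertex `o` over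
the random Hamiltonians, `dk(B) = 𝔼 μ_o^ω(B)`. -/
def densityOfStates {V Ω : Type*} [MeasurableSpace Ω] (P : Measure Ω) (G : SimpleGraph V)
    (a : G.edgeSet → Ω → ℝ) (b : V → Ω → ℝ) (o : V) : Measure ℝ :=
  P.bind fun ω => spectralMeasure (andersonOperator G a b ω) (deltaVec o)

end

/-! ### Automorphisms of regular trees. -/

namespace SimpleGraph

variable {V : Type*} {G : SimpleGraph V}

/-! The identity is proved by differentiating in `z` and fixing the constant of integration at `i∞`.
Write `m_u`, `m_v` for the Green's functions at the two ends of an edge `uv` after its coupling `a`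
is set to zero; these are the two m-functions of the edge (`greenVec_removeEdge`). The resolvent
equation gives `1/G_u = b_u - z - ∑ a² m_v` at a vertex (`greenFunction_vertex`) and `G_u = m_u / (1
- a² m_u m_v)` across an edge (`greenVec_edge`). Logarithmic differentiation turns them into
`G_u'/G_u = G_u + ∑ a² m_v' G_u` and `G_u'/G_u - m_u'/m_u = a² m_v' G_u + a² m_u' G_v`.

A regular tree has an automorphism carrying any dart to any other (`IsTree.exists_iso_dart`), and
the law of the parameters is invariant under automorphisms (`measurePreserving_reindex`). Hence
every `𝔼(a² m_v' G_u)` is the same number `Q`, so `𝔼(G'/G) = 𝔼 G + d Q` and `𝔼(G'/G) - 𝔼(m'/m) = 2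
Q`. Eliminating `Q` gives `-𝔼 G = (d/2 - 1) 𝔼(G'/G) - (d/2) 𝔼(m'/m)`, the derivative of the claim.

As for the constant, `G_u`, `m_e` and `(t - z)⁻¹` are all Stieltjes transforms of probability
measures on one compact interval, so their logarithms are `-log(-z) + O(1/y)` at `z = iy`. The
coefficients `1`, `d/2 - 1`, `-d/2` add up to zero, so the constant vanishes
(`linearCombination_eq_zero_of_deriv`). The compact support also gives the uniform bounds behind
integrability and differentiation under the expectation. -/

theorem Connected.exists_adj_dist_eq_add_one (hG : G.Connected) (x : V) {v : V} (hv : v ≠ x) :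
    ∃ w, G.Adj w v ∧ G.dist x v = G.dist x w + 1 := by
  obtain ⟨p, hp⟩ := (hG v x).exists_walk_length_eq_dist
  cases p with
  | nil => exact absurd rfl hv
  | @cons _ w _ h q =>
    refine ⟨w, h.symm, le_antisymm ?_ ?_⟩
    · have := hG.dist_triangle (u := x) (v := w) (w := v)
      rwa [dist_eq_one_iff_adj.mpr h.symm] at this
    · rw [Walk.length_cons] at hp
      rw [dist_comm (v := v), ← hp, dist_comm]
      exact Nat.succ_le_succ (dist_le q)

/-- Appending the edge to a geodesic from `x` to `w` gives a path from `x` to `v` with penultimate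
vertex `w`; paths in a tree are unique, so the parent is too. -/
theorem IsTree.eq_of_adj_of_dist_eq_add_one (hG : G.IsTree) {x v w w' : V}
    (h : G.Adj w v) (h' : G.Adj w' v) (hd : G.dist x v = G.dist x w + 1)
    (hd' : G.dist x v = G.dist x w' + 1) : w = w' := by
  have key : ∀ {w : V} (h : G.Adj w v), G.dist x v = G.dist x w + 1 →
      ∃ p : G.Walk x v, p.IsPath ∧ p.penultimate = w := by
    intro w h hd
    obtain ⟨q, hq⟩ := (hG.connected x w).exists_walk_length_eq_dist
    refine ⟨q.concat h, ?_, Walk.penultimate_concat _ _⟩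
    refine Walk.isPath_of_length_eq_dist _ ?_
    rw [Walk.length_concat, hq, hd]
  obtain ⟨p, hp, rfl⟩ := key h hd
  obtain ⟨q, hq, rfl⟩ := key h' hd'
  rw [(hG.existsUnique_path x v).unique hp hq]

/-- The neighbours of `u` that are farther from the root `x` than `u`. -/
def childSet (G : SimpleGraph V) (x u : V) : Set V :=
  {w | G.Adj u w ∧ G.dist x w = G.dist x u + 1}

theorem IsTree.mem_childSet_or (hG : G.IsTree) (x : V) {u v : V} (h : G.Adj u v) :
    v ∈ G.childSet x u ∨ u ∈ G.childSet x v := by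
  rcases hG.dist_eq_dist_add_one_of_adj x h with h1 | h1
  · exact Or.inr ⟨h.symm, h1⟩
  · exact Or.inl ⟨h, h1⟩

theorem IsTree.exists_mem_childSet (hG : G.IsTree) (x : V) {v : V} (hv : v ≠ x) :
    ∃ u, v ∈ G.childSet x u :=
  hG.connected.exists_adj_dist_eq_add_one x hv

theorem childSet_self (G : SimpleGraph V) (x : V) : G.childSet x x = G.neighborSet x := by
  ext w
  simp only [childSet, dist_self, zero_add, Set.mem_ofPred_eq, mem_neighborSet, and_iff_left_iff_imp]
  exact fun h => dist_eq_one_iff_adj.mpr h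

theorem IsTree.insert_childSet (hG : G.IsTree) {x u v : V} (hv : v ∈ G.childSet x u) :
    insert u (G.childSet x v) = G.neighborSet v := by
  ext w
  simp only [Set.mem_insert_iff, mem_neighborSet]
  constructor
  · rintro (rfl | h)
    · exact hv.1.symm
    · exact h.1
  · intro h
    rcases hG.mem_childSet_or x h with h1 | h1
    · exact Or.inr h1
    · exact Or.inl (hG.eq_of_adj_of_dist_eq_add_one h1.1 hv.1 h1.2 hv.2)

/-- A vertex other than the root loses exactly its parent from its `d` neighbours. Thus the child
count depends only on whether the vertex is the root, which is what lets two rooted copies of the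
tree be matched. -/
theorem IsTree.ncard_childSet [G.LocallyFinite] (hG : G.IsTree) {d : ℕ}
    (hreg : G.IsRegularOfDegree d) (x v : V) [Decidable (v = x)] :
    (G.childSet x v).ncard = if v = x then d else d - 1 := by
  have hN : ∀ v, (G.neighborSet v).ncard = d := fun v => by
    rw [Set.ncard_eq_toFinset_card', ← hreg v]; rfl
  split_ifs with h
  · rw [h, childSet_self, hN]
  · obtain ⟨u, hu⟩ := hG.exists_mem_childSet x h
    have hfin : (G.childSet x v).Finite := (Set.toFinite (G.neighborSet v)).subset fun w hw => hw.1
    have hnot : u ∉ G.childSet x v := fun h' => by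
      have := h'.2
      have := hu.2
      omega
    have := Set.ncard_insert_of_notMem hnot hfin
    rw [hG.insert_childSet hu, hN] at this
    omega

/-- A regular tree has an automorphism carrying any given dart to any other one. -/
theorem IsTree.exists_iso_dart [G.LocallyFinite] (hG : G.IsTree) {d : ℕ}
    (hreg : G.IsRegularOfDegree d) {x y x' y' : V} (hxy : G.Adj x y) (hxy' : G.Adj x' y') :
    ∃ σ : G ≃g G, σ x = x' ∧ σ y = y' := by
  classical
  have hfin : ∀ x u, (G.childSet x u).Finite := fun x u =>
    (Set.toFinite (G.neighborSet u)).subset fun w hw => hw.1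
  -- Child bijections are chosen for all pairs `(u, u')` at once, with junk for unmatched pairs, so
  -- that the recursion below needs no dependent data.
  have hex : ∀ u u', ∃ f : V → V, (u = x ↔ u' = x') →
      Set.BijOn f (G.childSet x u) (G.childSet x' u') ∧ (u = x → f y = y') := by
    intro u u'
    by_cases hu : u = x ↔ u' = x'
    · have hcard : (G.childSet x u).ncard = (G.childSet x' u').ncard := by
        rw [hG.ncard_childSet hreg, hG.ncard_childSet hreg]
        simp only [hu]
      have : Nonempty V := ⟨x⟩
      obtain ⟨f, hf⟩ := (hfin x u).exists_bijOn_of_encard_eq (t := G.childSet x' u') (by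
        rw [← (hfin x u).cast_ncard_eq, ← (hfin x' u').cast_ncard_eq, hcard])
      by_cases hux : u = x
      · have hu'x : u' = x' := hu.mp hux
        subst hux hu'x
        have hy : f y ∈ G.childSet u' u' := hf.mapsTo (by rw [childSet_self]; exact hxy)
        have hy' : y' ∈ G.childSet u' u' := by rw [childSet_self]; exact hxy'
        -- At the roots, a transposition of the target corrects the bijection so that `y` goes to
        -- `y'`.
        refine ⟨Equiv.swap (f y) y' ∘ f, fun _ => ⟨?_, fun _ => by simp⟩⟩
        refine Set.BijOn.comp (t := G.childSet u' u') ?_ hf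
        refine Set.BijOn.mk ?_ (Equiv.injective _).injOn ?_
        · intro w hw
          rw [Equiv.swap_apply_def]
          split_ifs <;> assumption
        · intro w hw
          refine ⟨Equiv.swap (f y) y' w, ?_, by simp⟩
          rw [Equiv.swap_apply_def]
          split_ifs <;> assumption
      · exact ⟨f, fun _ => ⟨hf, fun h => absurd h hux⟩⟩
    · exact ⟨id, fun h => absurd h hu⟩
  choose c hc using hex
  have hpar : ∀ v, ∃ u, v ≠ x → v ∈ G.childSet x u := fun v => by
    by_cases h : v = x
    · exact ⟨x, fun h' => absurd h h'⟩
    · obtain ⟨u, hu⟩ := hG.exists_mem_childSet x h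
      exact ⟨u, fun _ => hu⟩
  choose p hp using hpar
  -- `τ n` is meaningful only on the sphere of radius `n` about `x`: there it applies the child
  -- bijection of the parent to the value of the previous stage at the parent.
  let τ : ℕ → V → V := fun n => Nat.rec (fun _ => x') (fun _ s v => c (p v) (s (p v)) v) n
  let σ : V → V := fun v => τ (G.dist x v) v
  have hσx : σ x = x' := by simp [σ, τ]
  have hσ : ∀ u v, v ∈ G.childSet x u → σ v = c u (σ u) v := by
    intro u v hv
    have hvx : v ≠ x := by
      rintro rfl
      have := hv.2
      simp at this
    have hpu : p v = u := hG.eq_of_adj_of_dist_eq_add_one (hp v hvx).1 hv.1 (hp v hvx).2 hv.2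
    have : σ v = τ (G.dist x u + 1) v := by simp only [σ, hv.2]
    rw [this]
    change c (p v) (τ (G.dist x u) (p v)) v = _
    rw [hpu]
  have hdist : ∀ n v, G.dist x v = n → G.dist x' (σ v) = n := by
    intro n
    induction n with
    | zero =>
      intro v hv
      have : x = v := (hG.connected.dist_eq_zero_iff).mp hv
      rw [← this, hσx, dist_self]
    | succ n ih =>
      intro v hv
      have hvx : v ≠ x := by
        rintro rfl
        simp at hv
      have h1 := hp v hvx
      have h2 := ih (p v) (by have := h1.2; omega)
      have h3 : p v = x ↔ σ (p v) = x' := by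
        rw [eq_comm, ← hG.connected.dist_eq_zero_iff, eq_comm (b := x'),
          ← hG.connected.dist_eq_zero_iff, h2]
        have := h1.2
        omega
      have h4 := (hc _ _ h3).1.mapsTo h1
      rw [← hσ _ _ h1] at h4
      rw [h4.2, h2]
  have hroot : ∀ u, u = x ↔ σ u = x' := by
    intro u
    rw [eq_comm, ← hG.connected.dist_eq_zero_iff, eq_comm (b := x'),
          ← hG.connected.dist_eq_zero_iff, hdist _ u rfl]
  have hchild : ∀ u v, v ∈ G.childSet x u → σ v ∈ G.childSet x' (σ u) := by
    intro u v hv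
    rw [hσ u v hv]
    exact (hc _ _ (hroot u)).1.mapsTo hv
  -- Equal images have equal parents, so the parents of `v` and `w` agree by induction, and the
  -- bijection on their common children concludes.
  have hinj : ∀ n v w, G.dist x v = n → G.dist x w = n → σ v = σ w → v = w := by
    intro n
    induction n with
    | zero =>
      intro v w hv hw _
      rw [← (hG.connected.dist_eq_zero_iff).mp hv, ← (hG.connected.dist_eq_zero_iff).mp hw]
    | succ n ih =>
      intro v w hv hw hvw
      have hvx : v ≠ x := by rintro rfl; simp at hv
      have hwx : w ≠ x := by rintro rfl; simp at hw
      have h1 := hp v hvx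
      have h2 := hp w hwx
      have h3 := hchild _ _ h1
      have h4 := hchild _ _ h2
      rw [← hvw] at h4
      have h5 : σ (p v) = σ (p w) := hG.eq_of_adj_of_dist_eq_add_one h3.1 h4.1 h3.2 h4.2
      have h6 : p v = p w := ih _ _ (by have := h1.2; omega) (by have := h2.2; omega) h5
      rw [← h6] at h2
      refine (hc _ _ (hroot (p v))).1.injOn h1 h2 ?_
      rw [← hσ _ _ h1, ← hσ _ _ h2, hvw]
  have hinj' : Function.Injective σ := fun v w h =>
    hinj _ v w rfl (by rw [← hdist _ v rfl, ← hdist _ w rfl, h]) h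
  have hsurj' : ∀ u v', v' ∈ G.childSet x' (σ u) → ∃ v ∈ G.childSet x u, σ v = v' := by
    intro u v' hv'
    obtain ⟨v, hv, h⟩ := (hc _ _ (hroot u)).1.surjOn hv'
    exact ⟨v, hv, by rw [hσ _ _ hv, h]⟩
  have hsurj : ∀ n v', G.dist x' v' = n → ∃ v, σ v = v' := by
    intro n
    induction n with
    | zero =>
      intro v' hv'
      exact ⟨x, by rw [hσx, (hG.connected.dist_eq_zero_iff).mp hv']⟩
    | succ n ih =>
      intro v' hv'
      obtain ⟨u', hu'⟩ := hG.exists_mem_childSet x' (v := v') (by rintro rfl; simp at hv')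
      obtain ⟨u, rfl⟩ := ih u' (by have := hu'.2; omega)
      obtain ⟨v, -, hv⟩ := hsurj' u v' hu'
      exact ⟨v, hv⟩
  have hσsurj : Function.Surjective σ := fun v' => hsurj _ v' rfl
  refine ⟨⟨Equiv.ofBijective σ ⟨hinj', hσsurj⟩, ?_⟩, hσx, ?_⟩
  · intro v w
    change G.Adj (σ v) (σ w) ↔ G.Adj v w
    constructor
    · intro h
      rcases hG.mem_childSet_or x' h with h1 | h1
      · obtain ⟨w', hw', h2⟩ := hsurj' v _ h1
        rw [← hinj' h2]
        exact hw'.1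
      · obtain ⟨v', hv', h2⟩ := hsurj' w _ h1
        rw [← hinj' h2]
        exact hv'.1.symm
    · intro h
      rcases hG.mem_childSet_or x h with h1 | h1
      · exact (hchild _ _ h1).1
      · exact (hchild _ _ h1).1.symm
  · have hy : y ∈ G.childSet x x := by rw [childSet_self]; exact hxy
    change σ y = y'
    rw [hσ x y hy]
    exact (hc _ _ (hroot x)).2 rfl

/-- Each sphere lies in the union of the finite neighbour sets of the previous one. Countability is
what allows the almost sure bounds on single parameters to hold simultaneously. -/
theorem Connected.countable_of_locallyFinite [G.LocallyFinite] (hG : G.Connected) :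
    Countable V := by
  obtain ⟨x⟩ := hG.nonempty
  have hfin : ∀ n, {v | G.dist x v = n}.Countable := by
    intro n
    induction n with
    | zero =>
      refine (Set.countable_singleton x).mono fun v hv => ?_
      exact ((hG.dist_eq_zero_iff).mp hv).symm
    | succ n ih =>
      refine (ih.biUnion fun u _ => (Set.toFinite (G.neighborSet u)).countable).mono ?_
      intro v hv
      obtain ⟨w, hw, hd⟩ := hG.exists_adj_dist_eq_add_one x (v := v) (by
        rintro rfl
        simp at hv)
      simp only [Set.mem_iUnion]
      refine ⟨w, ?_, hw⟩
      change G.dist x w = n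
      change G.dist x v = n + 1 at hv
      omega
  rw [← Set.countable_univ_iff]
  refine (Set.countable_iUnion hfin).mono fun v _ => ?_
  simp

end SimpleGraph

/-! ### Norm bounds, self-adjointness and resolvents of Jacobi operators. -/

theorem IsJacobiOperator.norm_le {V : Type*} {G : SimpleGraph V} {a : G.edgeSet → ℝ} {b : V → ℝ}
    {T : EllTwo V →L[ℂ] EllTwo V} (hT : IsJacobiOperator G a b T)
    (D : ℕ) (hD : ∀ u, (G.neighborSet u).encard ≤ D) (C : ℝ) (hC : 0 ≤ C)
    (ha : ∀ e, |a e| ≤ C) (hb : ∀ u, |b u| ≤ C) : ‖T‖ ≤ C * (D + 1) := by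
  classical
  have hfin : ∀ u, (G.neighborSet u).Finite := fun u =>
    Set.finite_of_encard_le_coe (hD u)
  let _ : ∀ u, Fintype (G.neighborSet u) := fun u => (hfin u).fintype
  have hcard : ∀ u, (G.neighborFinset u).card ≤ D := by
    intro u
    have := hD u
    rw [← SimpleGraph.coe_neighborFinset, Set.encard_coe_eq_coe_finsetCard] at this
    exact_mod_cast this
  have hpt : ∀ (ψ : V → ℂ) (u : V), ‖jacobiAction G a b ψ u‖ ^ 2 ≤
      C ^ 2 * (D + 1) * (‖ψ u‖ ^ 2 + ∑ v ∈ G.neighborFinset u, ‖ψ v‖ ^ 2) := by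
    intro ψ u
    have h1 : ‖jacobiAction G a b ψ u‖ ≤ C * (‖ψ u‖ + ∑ v ∈ G.neighborFinset u, ‖ψ v‖) := by
      unfold jacobiAction
      rw [finsum_eq_sum_of_fintype, mul_add]
      refine (norm_add_le _ _).trans (add_le_add ?_ ?_)
      · rw [norm_mul, Complex.norm_real]
        exact mul_le_mul_of_nonneg_right (hb u) (norm_nonneg _)
      · rw [Finset.mul_sum]
        refine (norm_sum_le _ _).trans ?_
        have : ∑ v ∈ G.neighborFinset u, C * ‖ψ v‖ = ∑ v : G.neighborSet u, C * ‖ψ v‖ := by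
          rw [SimpleGraph.neighborFinset, ← Finset.sum_coe_sort]
          exact Fintype.sum_equiv (Equiv.subtypeEquivRight (by simp)) _ _ (by simp)
        rw [this]
        refine Finset.sum_le_sum fun v _ => ?_
        rw [norm_mul, Complex.norm_real]
        exact mul_le_mul_of_nonneg_right (ha _) (norm_nonneg _)
    have h2 : (‖ψ u‖ + ∑ v ∈ G.neighborFinset u, ‖ψ v‖) ^ 2 ≤
        (D + 1) * (‖ψ u‖ ^ 2 + ∑ v ∈ G.neighborFinset u, ‖ψ v‖ ^ 2) := by
      have hu : u ∉ G.neighborFinset u := by simp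
      have := sq_sum_le_card_mul_sum_sq (s := insert u (G.neighborFinset u))
        (f := fun v => ‖ψ v‖)
      rw [Finset.sum_insert hu, Finset.sum_insert hu, Finset.card_insert_of_notMem hu] at this
      refine this.trans (mul_le_mul_of_nonneg_right ?_ ?_)
      · have := hcard u
        exact_mod_cast Nat.succ_le_succ this
      · exact add_nonneg (sq_nonneg _) (Finset.sum_nonneg fun _ _ => sq_nonneg _)
    calc ‖jacobiAction G a b ψ u‖ ^ 2
        ≤ (C * (‖ψ u‖ + ∑ v ∈ G.neighborFinset u, ‖ψ v‖)) ^ 2 :=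
          pow_le_pow_left₀ (norm_nonneg _) h1 2
      _ ≤ _ := by
          rw [mul_pow, mul_assoc]
          exact mul_le_mul_of_nonneg_left h2 (sq_nonneg _)
  have hsum : ∀ (ψ : EllTwo V) (s : Finset V),
      ∑ u ∈ s, ‖jacobiAction G a b ψ u‖ ^ 2 ≤ (C * (D + 1) * ‖ψ‖) ^ 2 := by
    intro ψ s
    have hl : ∀ t : Finset V, ∑ u ∈ t, ‖ψ u‖ ^ 2 ≤ ‖ψ‖ ^ 2 := by
      intro t
      have := lp.sum_rpow_le_norm_rpow (p := 2) (by simp) ψ t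
      simpa using this
    -- Double counting: each `v` occurs once for each of its at most `D` neighbours in `s`.
    -- Cauchy–Schwarz at a vertex contributes the other factor `D + 1`.
    have hdc : ∑ u ∈ s, ∑ v ∈ G.neighborFinset u, ‖ψ v‖ ^ 2 ≤ D * ‖ψ‖ ^ 2 := by
      have h3 : ∑ u ∈ s, ∑ v ∈ G.neighborFinset u, ‖ψ v‖ ^ 2 =
          ∑ v ∈ s.biUnion (fun u => G.neighborFinset u),
            ∑ _u ∈ s.filter (fun u => v ∈ G.neighborFinset u), ‖ψ v‖ ^ 2 := by
        refine Finset.sum_comm' ?_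
        intro x y
        simp only [Finset.mem_filter, Finset.mem_biUnion]
        exact ⟨fun h => ⟨h, x, h⟩, fun h => h.1⟩
      rw [h3]
      calc _ ≤ ∑ v ∈ s.biUnion (fun u => G.neighborFinset u), (D : ℝ) * ‖ψ v‖ ^ 2 := by
            refine Finset.sum_le_sum fun v _ => ?_
            rw [Finset.sum_const, nsmul_eq_mul]
            refine mul_le_mul_of_nonneg_right ?_ (sq_nonneg _)
            have : s.filter (fun u => v ∈ G.neighborFinset u) ⊆ G.neighborFinset v := by
              intro x hx
              simp only [Finset.mem_filter, SimpleGraph.mem_neighborFinset] at hx ⊢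
              exact hx.2.symm
            exact_mod_cast (Finset.card_le_card this).trans (hcard v)
        _ ≤ _ := by
            rw [← Finset.mul_sum]
            exact mul_le_mul_of_nonneg_left (hl _) (Nat.cast_nonneg _)
    calc _ ≤ ∑ u ∈ s, C ^ 2 * (D + 1) *
            (‖ψ u‖ ^ 2 + ∑ v ∈ G.neighborFinset u, ‖ψ v‖ ^ 2) :=
          Finset.sum_le_sum fun u _ => hpt ψ u
      _ = C ^ 2 * (D + 1) *
            (∑ u ∈ s, ‖ψ u‖ ^ 2 + ∑ u ∈ s, ∑ v ∈ G.neighborFinset u, ‖ψ v‖ ^ 2) := by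
          rw [← Finset.mul_sum, Finset.sum_add_distrib]
      _ ≤ C ^ 2 * (D + 1) * (‖ψ‖ ^ 2 + D * ‖ψ‖ ^ 2) :=
          mul_le_mul_of_nonneg_left (add_le_add (hl s) hdc) (by positivity)
      _ = _ := by ring
  refine T.opNorm_le_bound (by positivity) fun ψ => ?_
  refine lp.norm_le_of_forall_sum_le (p := 2) (by simp) (by positivity) fun s => ?_
  simpa [hT ψ _] using hsum ψ s

section Resolvent

variable {V : Type*}

theorem inner_deltaVec (u : V) (ψ : EllTwo V) : inner ℂ (deltaVec u) ψ = ψ u := by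
  classical
  unfold deltaVec
  rw [lp.inner_single_left]
  simp

open Classical in
theorem deltaVec_apply (u v : V) : deltaVec u v = if v = u then 1 else 0 := by
  unfold deltaVec
  rw [lp.single_apply]
  simp [Pi.single_apply]

theorem norm_deltaVec (u : V) : ‖deltaVec u‖ = 1 := by
  classical
  unfold deltaVec
  rw [lp.norm_single (by simp)]
  simp

/-- The couplings are real and live on undirected edges, so `T δ_u` has the entries of row `u`;
pairing it with `ψ` gives `(T ψ)(u)`. -/
theorem IsJacobiOperator.isSelfAdjoint {G : SimpleGraph V} {a : G.edgeSet → ℝ} {b : V → ℝ}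
    {T : EllTwo V →L[ℂ] EllTwo V} (hT : IsJacobiOperator G a b T)
    (hfin : ∀ u, (G.neighborSet u).Finite) : IsSelfAdjoint T := by
  classical
  let _ : ∀ u, Fintype (G.neighborSet u) := fun u => (hfin u).fintype
  have hδ : ∀ u, T (deltaVec u) = (b u : ℂ) • deltaVec u +
      ∑ v : G.neighborSet u, (a ⟨s(u, (v : V)), v.2⟩ : ℂ) • deltaVec (v : V) := by
    intro u
    ext w
    rw [hT, jacobiAction, finsum_eq_sum_of_fintype, lp.coeFn_add, Pi.add_apply,
      lp.coeFn_smul, Pi.smul_apply, lp.coeFn_sum, Finset.sum_apply]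
    simp only [lp.coeFn_smul, Pi.smul_apply, deltaVec_apply, smul_eq_mul, mul_ite, mul_one,
      mul_zero]
    congr 1
    · split_ifs with h <;> simp [h]
    · by_cases hw : G.Adj u w
      · rw [Finset.sum_eq_single (⟨u, hw.symm⟩ : G.neighborSet w),
          Finset.sum_eq_single (⟨w, hw⟩ : G.neighborSet u)]
        · simp only [if_true]
          congr 3
          exact Sym2.eq_swap
        · rintro ⟨v, hv⟩ - hne
          rw [if_neg]
          rintro rfl
          exact hne rfl
        · simp
        · rintro ⟨v, hv⟩ - hne
          rw [if_neg]
          rintro rfl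
          exact hne rfl
        · simp
      · rw [Finset.sum_eq_zero, Finset.sum_eq_zero]
        · rintro ⟨v, hv⟩ -
          rw [if_neg]
          rintro rfl
          exact hw hv
        · rintro ⟨v, hv⟩ -
          rw [if_neg]
          rintro rfl
          exact hw (SimpleGraph.Adj.symm hv)
  rw [ContinuousLinearMap.isSelfAdjoint_iff']
  ext ψ u
  rw [← inner_deltaVec, ContinuousLinearMap.adjoint_inner_right, hδ, inner_add_left,
    sum_inner, hT, jacobiAction, finsum_eq_sum_of_fintype]
  simp only [inner_smul_left, inner_deltaVec, Complex.conj_ofReal]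

theorem jacobiOperator_spec {G : SimpleGraph V} {a : G.edgeSet → ℝ} {b : V → ℝ}
    (D : ℕ) (hD : ∀ u, (G.neighborSet u).encard ≤ D) (C : ℝ) (hC : 0 ≤ C)
    (ha : ∀ e, |a e| ≤ C) (hb : ∀ u, |b u| ≤ C) :
    IsJacobiOperator G a b (jacobiOperator G a b) := by
  have h := exists_isJacobiOperator G a b D hD C hC ha hb
  rw [jacobiOperator, dif_pos h]
  exact h.choose_spec

section Abstract

variable {E : Type*} [NormedAddCommGroup E] [InnerProductSpace ℂ E] [CompleteSpace E]
  {T : E →L[ℂ] E} {z : ℂ}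

theorem IsSelfAdjoint.isUnit_sub_smul_one (hT : IsSelfAdjoint T) (hz : z.im ≠ 0) :
    IsUnit (T - z • (1 : E →L[ℂ] E)) := by
  by_contra h
  refine hz (hT.im_eq_zero_of_mem_spectrum (z := z) ?_)
  rw [spectrum.mem_iff, Algebra.algebraMap_eq_smul_one]
  intro h'
  rw [← neg_sub] at h
  exact h h'.neg

theorem IsSelfAdjoint.sub_smul_inverse_apply (hT : IsSelfAdjoint T) (hz : z.im ≠ 0) (x : E) :
    T (Ring.inverse (T - z • (1 : E →L[ℂ] E)) x) -
      z • Ring.inverse (T - z • (1 : E →L[ℂ] E)) x = x := by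
  have h := Ring.mul_inverse_cancel _ (hT.isUnit_sub_smul_one hz)
  have := congrArg (fun S : E →L[ℂ] E => S x) h
  simpa using this

theorem IsSelfAdjoint.inverse_apply_eq (hT : IsSelfAdjoint T) (hz : z.im ≠ 0) {x y : E}
    (h : T y - z • y = x) : Ring.inverse (T - z • (1 : E →L[ℂ] E)) x = y := by
  have h1 := Ring.inverse_mul_cancel _ (hT.isUnit_sub_smul_one hz)
  have := congrArg (fun S : E →L[ℂ] E => S y) h1
  simpa [h] using this

end Abstract

/-- The vector `(T - z)⁻¹ δ_u`. -/
noncomputable def greenVec (T : EllTwo V →L[ℂ] EllTwo V) (u : V) (z : ℂ) : EllTwo V :=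
  Ring.inverse (T - z • (1 : EllTwo V →L[ℂ] EllTwo V)) (deltaVec u)

theorem greenFunction_eq (T : EllTwo V →L[ℂ] EllTwo V) (u : V) (z : ℂ) :
    greenFunction T u z = greenVec T u z u := by
  rw [greenFunction, inner_deltaVec, greenVec]

/-- Extension by zero of a square-summable function along an injective map. -/
noncomputable def lpExtend {W : Type*} (f : W ↪ V) (ψ : EllTwo W) : EllTwo V :=
  ⟨Function.extend f ψ 0, by
    change Memℓp (Function.extend f ψ 0) 2
    have h := lp.memℓp ψ
    rw [memℓp_gen_iff (by simp)] at h ⊢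
    rw [← f.injective.summable_iff]
    · convert h using 2 with i
      simp [f.injective.extend_apply]
    · intro v hv
      rw [Function.extend_apply' _ _ _ (by simpa using hv)]
      simp⟩

theorem lpExtend_apply {W : Type*} (f : W ↪ V) (ψ : EllTwo W) (w : W) :
    lpExtend f ψ (f w) = ψ w :=
  f.injective.extend_apply _ _ _

theorem lpExtend_apply_of_notMem {W : Type*} (f : W ↪ V) (ψ : EllTwo W) {v : V}
    (hv : v ∉ Set.range f) : lpExtend f ψ v = 0 :=
  Function.extend_apply' _ _ _ (by simpa using hv)

theorem lpExtend_deltaVec {W : Type*} (f : W ↪ V) (w : W) :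
    lpExtend f (deltaVec w) = deltaVec (f w) := by
  ext v
  by_cases hv : v ∈ Set.range f
  · obtain ⟨w', rfl⟩ := hv
    rw [lpExtend_apply, deltaVec_apply, deltaVec_apply]
    by_cases h : w' = w
    · rw [if_pos h, if_pos (congrArg f h)]
    · rw [if_neg h, if_neg (f.injective.ne h)]
  · rw [lpExtend_apply_of_notMem f _ hv, deltaVec_apply, if_neg]
    rintro rfl
    exact hv ⟨w, rfl⟩

/-- If no coupling joins the image of a graph embedding to its complement, the Jacobi operators
are intertwined by the extension by zero. -/
theorem IsJacobiOperator.apply_lpExtend {W : Type*} {G : SimpleGraph V} {G' : SimpleGraph W}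
    (f : G' ↪g G) {a : G.edgeSet → ℝ} {b : V → ℝ} {T : EllTwo V →L[ℂ] EllTwo V}
    (hT : IsJacobiOperator G a b T) {T' : EllTwo W →L[ℂ] EllTwo W}
    (hT' : IsJacobiOperator G' (fun e => a (f.mapEdgeSet e)) (fun w => b (f w)) T')
    (ha : ∀ (w : W) (v : V) (h : G.Adj (f w) v), v ∉ Set.range f → a ⟨s(f w, v), h⟩ = 0)
    (ψ : EllTwo W) : T (lpExtend f.toEmbedding ψ) = lpExtend f.toEmbedding (T' ψ) := by
  ext v
  rw [hT, jacobiAction]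
  by_cases hv : v ∈ Set.range f
  · obtain ⟨w, rfl⟩ := hv
    have h1 : lpExtend f.toEmbedding ψ (f w) = ψ w := lpExtend_apply f.toEmbedding ψ w
    have h2 : lpExtend f.toEmbedding (T' ψ) (f w) = T' ψ w := lpExtend_apply f.toEmbedding _ w
    rw [h1, h2, hT', jacobiAction]
    congr 1
    rw [← finsum_mem_univ, ← finsum_mem_inter_support_eq (s := Set.range (f.mapNeighborSet w)),
      finsum_mem_range (f.mapNeighborSet w).injective]
    · refine finsum_congr fun w' => ?_
      congr 1
      exact lpExtend_apply f.toEmbedding ψ w'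
    · rw [Set.univ_inter, Set.inter_eq_right]
      rintro ⟨v, hv⟩ hne
      have hvr : v ∈ Set.range f := by
        by_contra hvr
        apply hne
        have := lpExtend_apply_of_notMem f.toEmbedding ψ hvr
        simp [this]
      obtain ⟨w', rfl⟩ := hvr
      exact ⟨⟨w', f.map_adj_iff.mp hv⟩, rfl⟩
  · have h1 : lpExtend f.toEmbedding ψ v = 0 := lpExtend_apply_of_notMem f.toEmbedding ψ hv
    have h2 : lpExtend f.toEmbedding (T' ψ) v = 0 := lpExtend_apply_of_notMem f.toEmbedding _ hv
    rw [h1, h2, mul_zero, zero_add, ← finsum_zero (α := G.neighborSet v)]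
    refine finsum_congr fun v' => ?_
    by_cases hv' : (v' : V) ∈ Set.range f
    · obtain ⟨w, hw⟩ := hv'
      have h3 : G.Adj (f w) v := hw ▸ v'.2.symm
      have h4 : (⟨s(v, (v' : V)), v'.2⟩ : G.edgeSet) = ⟨s(f w, v), h3⟩ := by
        apply Subtype.ext
        simp only [hw]
        exact Sym2.eq_swap
      rw [h4, ha w v h3 hv]
      simp
    · have := lpExtend_apply_of_notMem f.toEmbedding ψ hv'
      rw [this, mul_zero]

/-- The extension by zero of the small resolvent vector solves the large resolvent equation, whose
solution is unique. This serves both for splitting off a branch and for transport by automorphisms.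
-/
theorem IsJacobiOperator.greenVec_lpExtend {W : Type*} {G : SimpleGraph V} {G' : SimpleGraph W}
    (f : G' ↪g G) {a : G.edgeSet → ℝ} {b : V → ℝ} {T : EllTwo V →L[ℂ] EllTwo V}
    (hT : IsJacobiOperator G a b T) (hTs : IsSelfAdjoint T) {T' : EllTwo W →L[ℂ] EllTwo W}
    (hT' : IsJacobiOperator G' (fun e => a (f.mapEdgeSet e)) (fun w => b (f w)) T')
    (hTs' : IsSelfAdjoint T')
    (ha : ∀ (w : W) (v : V) (h : G.Adj (f w) v), v ∉ Set.range f → a ⟨s(f w, v), h⟩ = 0)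
    {z : ℂ} (hz : z.im ≠ 0) (w : W) :
    greenVec T (f w) z = lpExtend f.toEmbedding (greenVec T' w z) := by
  refine hTs.inverse_apply_eq hz ?_
  have h := congrArg (lpExtend f.toEmbedding) (hTs'.sub_smul_inverse_apply hz (deltaVec w))
  rw [lpExtend_deltaVec] at h
  rw [hT.apply_lpExtend f hT' ha]
  refine Eq.trans ?_ h
  ext v
  by_cases hv : v ∈ Set.range f
  · obtain ⟨w', rfl⟩ := hv
    have h1 : ∀ φ, lpExtend f.toEmbedding φ (f w') = φ w' :=
      fun φ => lpExtend_apply f.toEmbedding φ w'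
    simp only [lp.coeFn_sub, Pi.sub_apply, lp.coeFn_smul, Pi.smul_apply, h1, greenVec]
  · have h1 : ∀ φ, lpExtend f.toEmbedding φ v = 0 :=
      fun φ => lpExtend_apply_of_notMem f.toEmbedding φ hv
    simp only [lp.coeFn_sub, Pi.sub_apply, lp.coeFn_smul, Pi.smul_apply, h1, smul_zero, sub_zero]

end Resolvent

/-! ### Cutting an edge of a tree: resolvent identities. -/

section EdgeRemoval

variable {V : Type*} {G : SimpleGraph V} {a : G.edgeSet → ℝ} {b : V → ℝ} {D : ℕ} {C : ℝ} {z : ℂ}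

/-- The edge of a dart, as an element of the edge set. -/
def SimpleGraph.Dart.edgeElem (e : G.Dart) : G.edgeSet := ⟨e.edge, e.edge_mem⟩

/-- The couplings with the one on the edge `e` set to zero. -/
noncomputable def removeEdge (a : G.edgeSet → ℝ) (e : G.edgeSet) : G.edgeSet → ℝ :=
  letI := Classical.decEq G.edgeSet
  Function.update a e 0

theorem removeEdge_self (a : G.edgeSet → ℝ) (e : G.edgeSet) : removeEdge a e e = 0 := by
  classical
  simp [removeEdge]

theorem removeEdge_of_ne (a : G.edgeSet → ℝ) {e f : G.edgeSet} (h : f ≠ e) :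
    removeEdge a e f = a f := by
  classical
  simp [removeEdge, h]

theorem abs_removeEdge_le (hC : 0 ≤ C) (ha : ∀ e, |a e| ≤ C) (e f : G.edgeSet) :
    |removeEdge a e f| ≤ C := by
  by_cases h : f = e
  · rw [h, removeEdge_self, abs_zero]
    exact hC
  · rw [removeEdge_of_ne a h]
    exact ha f

theorem edge_eq_of_forwardSet {e : G.Dart} {v w : V} (hv : v ∈ forwardSet G e)
    (hw : w ∉ forwardSet G e) (h : G.Adj v w) : s(v, w) = e.edge := by
  by_contra hne
  refine hw (SimpleGraph.Reachable.trans hv (SimpleGraph.Adj.reachable ?_))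
  rw [SimpleGraph.deleteEdges_adj]
  exact ⟨h, by simpa using hne⟩

theorem fst_notMem_forwardSet (hG : G.IsAcyclic) (e : G.Dart) : e.fst ∉ forwardSet G e := by
  have h := SimpleGraph.isAcyclic_iff_forall_isBridge.mp hG e.edge_mem
  obtain ⟨⟨u, v⟩, huv⟩ := e
  rw [SimpleGraph.Dart.edge_mk, SimpleGraph.isBridge_iff] at h
  exact fun h' => h (SimpleGraph.Reachable.symm h')

theorem encard_neighborSet_le_of_embedding {W : Type*} {G' : SimpleGraph W} (f : G' ↪g G)
    (hD : ∀ u, (G.neighborSet u).encard ≤ D) (w : W) : (G'.neighborSet w).encard ≤ D := by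
  refine le_trans ?_ (hD (f w))
  exact (f.mapNeighborSet w).encard_le

theorem jacobiOperator_isSelfAdjoint (hD : ∀ u, (G.neighborSet u).encard ≤ D) (hC : 0 ≤ C)
    (ha : ∀ e, |a e| ≤ C) (hb : ∀ u, |b u| ≤ C) : IsSelfAdjoint (jacobiOperator G a b) :=
  (jacobiOperator_spec D hD C hC ha hb).isSelfAdjoint
    fun u => Set.finite_of_encard_le_coe (hD u)

/-- With the coupling at zero, no interaction leaves the forward branch, so its resolvent vector,
extended by zero, is that of the cut operator. All m-functions thereby become Green's functions on
the single space `ℓ²(V)`, and the vector vanishes across the cut. -/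
theorem greenVec_removeEdge (hG : G.IsAcyclic) (hD : ∀ u, (G.neighborSet u).encard ≤ D)
    (hC : 0 ≤ C) (ha : ∀ e, |a e| ≤ C) (hb : ∀ u, |b u| ≤ C) (hz : z.im ≠ 0) (e : G.Dart) :
    mFunction G a b e z = greenFunction (jacobiOperator G (removeEdge a e.edgeElem) b) e.snd z ∧
      greenVec (jacobiOperator G (removeEdge a e.edgeElem) b) e.snd z e.fst = 0 := by
  let S := forwardSet G e
  let f : G.induce S ↪g G := SimpleGraph.Embedding.induce S
  have hrange : Set.range f = S := Subtype.range_coe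
  have ha0 := abs_removeEdge_le hC ha e.edgeElem
  have hfst : e.fst ∉ S := fst_notMem_forwardSet hG e
  -- The removed edge is not an edge of the induced graph, because its tail lies outside the branch.
  have heq : (fun e' => removeEdge a e.edgeElem (f.mapEdgeSet e')) =
      fun e' => a (f.mapEdgeSet e') := by
    funext e'
    refine removeEdge_of_ne a fun h => hfst ?_
    have h1 : Sym2.map f e' = s(e.fst, e.snd) := congrArg Subtype.val h
    have h2 : e.fst ∈ Sym2.map f (e' : Sym2 S) := by rw [h1]; exact Sym2.mem_mk_left _ _
    obtain ⟨w, -, hw⟩ := Sym2.mem_map.mp h2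
    rw [← hw]
    exact w.2
  have hDS := encard_neighborSet_le_of_embedding f hD
  have key := IsJacobiOperator.greenVec_lpExtend f
    (jacobiOperator_spec D hD C hC ha0 hb) (jacobiOperator_isSelfAdjoint hD hC ha0 hb)
    (T' := jacobiOperator (G.induce S) (fun e' => a (f.mapEdgeSet e')) (fun v => b v))
    (by rw [heq]
        exact jacobiOperator_spec D hDS C hC (fun e' => ha _) (fun v => hb _))
    (jacobiOperator_isSelfAdjoint hDS hC (fun e' => ha _) (fun v => hb _))
    (by
      intro w v h hv
      rw [hrange] at hv
      have : (⟨s(f w, v), h⟩ : G.edgeSet) = e.edgeElem :=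
        Subtype.ext (edge_eq_of_forwardSet w.2 hv h)
      rw [this, removeEdge_self])
    hz (⟨e.snd, SimpleGraph.Reachable.refl e.snd⟩ : S)
  change greenVec _ e.snd z = _ at key
  constructor
  · rw [greenFunction_eq, key, mFunction, greenFunction_eq]
    exact (lpExtend_apply f.toEmbedding _ _).symm
  · rw [key]
    refine lpExtend_apply_of_notMem f.toEmbedding _ ?_
    change e.fst ∉ Set.range f
    rwa [hrange]

theorem jacobiAction_removeEdge [G.LocallyFinite] {u v : V} (h : G.Adj u v) (ψ : V → ℂ) (w : V) :
    jacobiAction G a b ψ w = jacobiAction G (removeEdge a ⟨s(u, v), h⟩) b ψ w +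
      (a ⟨s(u, v), h⟩ : ℂ) * (ψ v * deltaVec u w + ψ u * deltaVec v w) := by
  classical
  simp only [jacobiAction, finsum_eq_sum_of_fintype, deltaVec_apply]
  rw [add_assoc]
  congr 1
  rw [← sub_eq_iff_eq_add', ← Finset.sum_sub_distrib]
  have hterm : ∀ x : G.neighborSet w, (a ⟨s(w, (x : V)), x.2⟩ : ℂ) * ψ x -
      (removeEdge a ⟨s(u, v), h⟩ ⟨s(w, (x : V)), x.2⟩ : ℂ) * ψ x =
      if s(w, (x : V)) = s(u, v) then (a ⟨s(u, v), h⟩ : ℂ) * ψ x else 0 := by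
    intro x
    split_ifs with hx
    · have : (⟨s(w, (x : V)), x.2⟩ : G.edgeSet) = ⟨s(u, v), h⟩ := Subtype.ext hx
      rw [this, removeEdge_self]
      simp
    · rw [removeEdge_of_ne, sub_self]
      exact fun h' => hx (congrArg Subtype.val h')
  rw [Finset.sum_congr rfl fun x _ => hterm x]
  by_cases hwu : w = u
  · subst hwu
    rw [Finset.sum_eq_single (⟨v, h⟩ : G.neighborSet w)]
    · simp [h.ne]
    · intro x _ hx
      rw [if_neg]
      intro h'
      rcases Sym2.eq_iff.mp h' with ⟨-, h2⟩ | ⟨h1, h2⟩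
      · exact hx (Subtype.ext h2)
      · exact h.ne h1
    · simp
  · by_cases hwv : w = v
    · subst hwv
      rw [Finset.sum_eq_single (⟨u, h.symm⟩ : G.neighborSet w)]
      · simp [h.ne', Sym2.eq_swap]
      · intro x _ hx
        rw [if_neg]
        intro h'
        rcases Sym2.eq_iff.mp h' with ⟨h1, h2⟩ | ⟨h1, h2⟩
        · exact h.ne h1.symm
        · exact hx (Subtype.ext h2)
      · simp
    · rw [Finset.sum_eq_zero]
      · simp [hwu, hwv]
      · intro x _
        rw [if_neg]
        intro h'
        rcases Sym2.eq_iff.mp h' with ⟨h1, h2⟩ | ⟨h1, h2⟩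
        · exact hwu h1
        · exact hwv h1

/-- Restoring the coupling `α` is a perturbation of rank at most two. With `R₀` the cut resolvent,
it gives `ψ = R₀ δ_u - α (ψ(v) R₀ δ_u + ψ(u) R₀ δ_v)` for the full resolvent vector `ψ`; evaluation
at `v` and `u` yields the two formulas, the cross entries of `R₀` being zero. -/
theorem greenVec_edge [G.LocallyFinite] (hG : G.IsAcyclic)
    (hD : ∀ u, (G.neighborSet u).encard ≤ D)
    (hC : 0 ≤ C) (ha : ∀ e, |a e| ≤ C) (hb : ∀ u, |b u| ≤ C) (hz : z.im ≠ 0) {u v : V}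
    (h : G.Adj u v) :
    greenVec (jacobiOperator G a b) u z v =
        -(a ⟨s(u, v), h⟩ * greenFunction (jacobiOperator G a b) u z *
          greenFunction (jacobiOperator G (removeEdge a ⟨s(u, v), h⟩) b) v z) ∧
      greenFunction (jacobiOperator G a b) u z =
        greenFunction (jacobiOperator G (removeEdge a ⟨s(u, v), h⟩) b) u z *
          (1 - a ⟨s(u, v), h⟩ * greenVec (jacobiOperator G a b) u z v) := by
  have ha0 := abs_removeEdge_le hC ha ⟨s(u, v), h⟩
  have hT := jacobiOperator_spec D hD C hC ha hb
  have hT0 := jacobiOperator_spec D hD C hC ha0 hb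
  have hs := jacobiOperator_isSelfAdjoint hD hC ha hb
  have hs0 := jacobiOperator_isSelfAdjoint hD hC ha0 hb
  have hvu := (greenVec_removeEdge hG hD hC ha hb hz ⟨(u, v), h⟩).2
  have huv := (greenVec_removeEdge hG hD hC ha hb hz ⟨(v, u), h.symm⟩).2
  have hswap : (SimpleGraph.Dart.edgeElem ⟨(v, u), h.symm⟩ : G.edgeSet) = ⟨s(u, v), h⟩ :=
    Subtype.ext Sym2.eq_swap
  rw [hswap] at huv
  change greenVec (jacobiOperator G (removeEdge a ⟨s(u, v), h⟩) b) v z u = 0 at hvu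
  change greenVec (jacobiOperator G (removeEdge a ⟨s(u, v), h⟩) b) u z v = 0 at huv
  simp only [greenFunction_eq]
  set T := jacobiOperator G a b
  set T0 := jacobiOperator G (removeEdge a ⟨s(u, v), h⟩) b
  set ψ := greenVec T u z
  set α : ℂ := (a ⟨s(u, v), h⟩ : ℂ)
  have h1 : T ψ - z • ψ = deltaVec u := hs.sub_smul_inverse_apply hz _
  have h2 : T ψ = T0 ψ + α • (ψ v • deltaVec u + ψ u • deltaVec v) := by
    ext w
    rw [hT, jacobiAction_removeEdge h, ← hT0 ψ w]
    rfl
  have h3 : T0 ψ - z • ψ = deltaVec u - α • (ψ v • deltaVec u + ψ u • deltaVec v) := by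
    rw [eq_sub_iff_add_eq]
    refine Eq.trans ?_ h1
    rw [h2]
    abel
  have h4 := hs0.inverse_apply_eq hz h3
  rw [map_sub, map_smul, map_add, map_smul, map_smul] at h4
  change greenVec T0 u z - α • (ψ v • greenVec T0 u z + ψ u • greenVec T0 v z) = ψ at h4
  have h5 : ∀ w, greenVec T0 u z w - α * (ψ v * greenVec T0 u z w + ψ u * greenVec T0 v z w)
      = ψ w := fun w => congrArg (fun φ : EllTwo V => φ w) h4
  have hu := h5 u
  have hv := h5 v
  rw [hvu] at hu
  rw [huv] at hv
  constructor
  · rw [← hv]; ring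
  · conv_lhs => rw [← hu]
    ring

/-- This is row `u` of `(H - z) ψ = δ_u`, with each neighbouring value of `ψ` replaced by means of
`greenVec_edge`. -/
theorem greenFunction_vertex [G.LocallyFinite] (hG : G.IsAcyclic)
    (hD : ∀ u, (G.neighborSet u).encard ≤ D)
    (hC : 0 ≤ C) (ha : ∀ e, |a e| ≤ C) (hb : ∀ u, |b u| ≤ C) (hz : z.im ≠ 0) (u : V) :
    greenFunction (jacobiOperator G a b) u z * (b u - z - ∑ v : G.neighborSet u,
      (a ⟨s(u, (v : V)), v.2⟩ : ℂ) ^ 2 *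
        greenFunction (jacobiOperator G (removeEdge a ⟨s(u, (v : V)), v.2⟩) b) v z) = 1 := by
  have hT := jacobiOperator_spec D hD C hC ha hb
  have hs := jacobiOperator_isSelfAdjoint hD hC ha hb
  have h1 := congrArg (fun φ : EllTwo V => φ u) (hs.sub_smul_inverse_apply hz (deltaVec u))
  change jacobiOperator G a b (greenVec (jacobiOperator G a b) u z) u -
    z * greenVec (jacobiOperator G a b) u z u = deltaVec u u at h1
  rw [hT, jacobiAction, finsum_eq_sum_of_fintype, deltaVec_apply, if_pos rfl,
    ← greenFunction_eq, Finset.sum_congr rfl fun v _ => by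
      rw [(greenVec_edge hG hD hC ha hb hz (show G.Adj u v from v.2)).1]] at h1
  rw [← h1, mul_sub, mul_sub, Finset.mul_sum, sub_eq_add_neg (_ - _), ← Finset.sum_neg_distrib]
  have : ∀ v : G.neighborSet u, -(greenFunction (jacobiOperator G a b) u z *
      ((a ⟨s(u, (v : V)), v.2⟩ : ℂ) ^ 2 *
        greenFunction (jacobiOperator G (removeEdge a ⟨s(u, (v : V)), v.2⟩) b) v z)) =
      (a ⟨s(u, (v : V)), v.2⟩ : ℂ) * -(a ⟨s(u, (v : V)), v.2⟩ *
        greenFunction (jacobiOperator G a b) u z *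
          greenFunction (jacobiOperator G (removeEdge a ⟨s(u, (v : V)), v.2⟩) b) v z) :=
    fun v => by ring
  rw [Finset.sum_congr rfl fun v _ => this v]
  ring

/-- Green's functions are transported by graph automorphisms. -/
theorem greenFunction_iso (σ : G ≃g G) (hD : ∀ u, (G.neighborSet u).encard ≤ D)
    (hC : 0 ≤ C) (ha : ∀ e, |a e| ≤ C) (hb : ∀ u, |b u| ≤ C) (hz : z.im ≠ 0) (u : V) :
    greenFunction (jacobiOperator G a b) (σ u) z =
      greenFunction (jacobiOperator G (fun e => a (σ.mapEdgeSet e)) (fun v => b (σ v))) u z := by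
  have ha' : ∀ e, |a (σ.mapEdgeSet e)| ≤ C := fun e => ha _
  have hb' : ∀ v, |b (σ v)| ≤ C := fun v => hb _
  have key := IsJacobiOperator.greenVec_lpExtend σ.toEmbedding
    (jacobiOperator_spec D hD C hC ha hb) (jacobiOperator_isSelfAdjoint hD hC ha hb)
    (jacobiOperator_spec D hD C hC ha' hb') (jacobiOperator_isSelfAdjoint hD hC ha' hb')
    (fun w v h hv => absurd (σ.surjective v) hv) hz u
  rw [greenFunction_eq, greenFunction_eq]
  change greenVec _ (σ u) z = _ at key
  rw [key]
  exact lpExtend_apply σ.toEmbedding.toEmbedding _ u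

end EdgeRemoval

/-! ### Spectral measures and the resolvent. -/

section SpectralMeasure

variable {E : Type*} [NormedAddCommGroup E] [InnerProductSpace ℂ E] [CompleteSpace E]
  {T : E →L[ℂ] E}

/-- The measures on `ℝ` that are probability measures carried by `[-K, K]`. -/
def IsProbOn (K : ℝ) (μ : Measure ℝ) : Prop :=
  IsProbabilityMeasure μ ∧ ∀ᵐ t ∂μ, |t| ≤ K

theorem IsProbOn.integrable_of_bound {K : ℝ} {μ : Measure ℝ} (hμ : IsProbOn K μ) {F : Type*}
    [NormedAddCommGroup F] {f : ℝ → F} (hf : AEStronglyMeasurable f μ) (B : ℝ)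
    (hB : ∀ t, |t| ≤ K → ‖f t‖ ≤ B) : Integrable f μ :=
  have := hμ.1
  Integrable.of_bound hf B (hμ.2.mono hB)

theorem IsProbOn.integrable_of_continuous {K : ℝ} {μ : Measure ℝ} (hμ : IsProbOn K μ) {F : Type*}
    [NormedAddCommGroup F] [SecondCountableTopology F] [MeasurableSpace F] [BorelSpace F]
    {f : ℝ → F} (hf : Continuous f) : Integrable f μ := by
  obtain ⟨B, hB⟩ := (isCompact_Icc (a := -K) (b := K)).exists_bound_of_continuousOn
    hf.continuousOn
  exact hμ.integrable_of_bound hf.aestronglyMeasurable B fun t ht => hB t (abs_le.mp ht)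

theorem spectralMeasure_facts (hT : IsSelfAdjoint T) (x : E) :
    IsFiniteMeasure (spectralMeasure T x) ∧ (∀ᵐ t ∂(spectralMeasure T x), t ∈ spectrum ℝ T) ∧
      ∀ f : ℝ → ℝ, Continuous f →
        ∫ t, f t ∂(spectralMeasure T x) = (inner ℂ x (cfc f T x)).re := by
  have hcomp : CompactSpace (spectrum ℝ T) :=
    isCompact_iff_compactSpace.mp (ContinuousFunctionalCalculus.isCompact_spectrum T)
  have hemb : MeasurableEmbedding (Subtype.val : spectrum ℝ T → ℝ) :=
    MeasurableEmbedding.subtype_coe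
      (ContinuousFunctionalCalculus.isCompact_spectrum T).isClosed.measurableSet
  have hdef : spectralMeasure T x =
      (RealRMK.rieszMeasure (spectralFunctional T hT x)).map Subtype.val := by
    rw [spectralMeasure, dif_pos hT]
  refine ⟨?_, ?_, fun f hf => ?_⟩
  · rw [hdef]
    infer_instance
  · rw [hdef, hemb.ae_map_iff]
    exact Filter.Eventually.of_forall fun t => t.2
  · rw [hdef, hemb.integral_map]
    let g : CompactlySupportedContinuousMap (spectrum ℝ T) ℝ :=
      ⟨⟨fun t => f t, hf.comp continuous_subtype_val⟩, HasCompactSupport.of_compactSpace _⟩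
    refine (RealRMK.integral_rieszMeasure (spectralFunctional T hT x) g).trans ?_
    rw [cfc_apply f T hT hf.continuousOn]
    rfl

theorem isProbOn_spectralMeasure (hT : IsSelfAdjoint T) {x : E} (hx : ‖x‖ = 1) {K : ℝ}
    (hK : ‖T‖ ≤ K) : IsProbOn K (spectralMeasure T x) := by
  obtain ⟨h1, h2, h3⟩ := spectralMeasure_facts hT x
  have hnt : Nontrivial E := ⟨x, 0, fun h => by simp [h] at hx⟩
  constructor
  · have := h3 (fun _ => 1) continuous_const
    rw [cfc_const_one ℝ T] at this
    simp only [integral_const, smul_eq_mul, mul_one] at this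
    change _ = (inner ℂ x x).re at this
    rw [inner_self_eq_norm_sq_to_K, hx] at this
    refine ⟨?_⟩
    rw [← ENNReal.toReal_eq_one_iff]
    simpa [Measure.real] using this
  · filter_upwards [h2] with t ht
    exact (spectrum.norm_le_norm_of_mem ht).trans hK

theorem integral_pow_spectralMeasure (hT : IsSelfAdjoint T) (x : E) (n : ℕ) :
    ∫ t, t ^ n ∂(spectralMeasure T x) = (inner ℂ x ((T ^ n) x)).re := by
  rw [(spectralMeasure_facts hT x).2.2 (fun t => t ^ n) (by fun_prop), cfc_pow_id T n]

/-- The Stieltjes transform `∫ (t - z)⁻¹ dμ(t)` of a measure on the line. -/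
noncomputable def stieltjes (μ : Measure ℝ) (z : ℂ) : ℂ := ∫ t : ℝ, ((t : ℂ) - z)⁻¹ ∂μ

theorem ofReal_sub_ne_zero {z : ℂ} (hz : z.im ≠ 0) (t : ℝ) : (t : ℂ) - z ≠ 0 := by
  intro h
  have := congrArg Complex.im h
  simp at this
  exact hz this

theorem continuous_inv_ofReal_sub {z : ℂ} (hz : z.im ≠ 0) :
    Continuous fun t : ℝ => ((t : ℂ) - z)⁻¹ :=
  (by fun_prop : Continuous fun t : ℝ => (t : ℂ) - z).inv₀ (ofReal_sub_ne_zero hz)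

theorem inner_cfc_self (f : ℝ → ℝ) (x : E) :
    ((inner ℂ x (cfc f T x)).re : ℂ) = inner ℂ x (cfc f T x) := by
  have hs : IsSelfAdjoint (cfc f T) := cfc_predicate f T
  rw [← Complex.conj_eq_iff_re, inner_conj_symm]
  exact (ContinuousLinearMap.isSelfAdjoint_iff_isSymmetric.mp hs) x x

/-- The spectral measure represents the real functional calculus only, so `(t - z)⁻¹` is split as
`f₁ + i f₂` and the vector `f₁(T) x + i f₂(T) x` is checked to solve the resolvent equation. -/
theorem stieltjes_spectralMeasure (hT : IsSelfAdjoint T) {x : E} (hx : ‖x‖ = 1) {z : ℂ}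
    (hz : z.im ≠ 0) : stieltjes (spectralMeasure T x) z =
      inner ℂ x (Ring.inverse (T - z • (1 : E →L[ℂ] E)) x) := by
  have hprob := isProbOn_spectralMeasure hT hx le_rfl
  have hpos : ∀ t : ℝ, (t - z.re) ^ 2 + z.im ^ 2 ≠ 0 := fun t => by positivity
  -- `q t = |t - z|⁻²`.
  let q : ℝ → ℝ := fun t => ((t - z.re) ^ 2 + z.im ^ 2)⁻¹
  have hq : Continuous q := (by fun_prop : Continuous fun t : ℝ => (t - z.re) ^ 2 + z.im ^ 2).inv₀
    hpos
  let f₁ : ℝ → ℝ := fun t => (t - z.re) * q t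
  let f₂ : ℝ → ℝ := fun t => z.im * q t
  have hf₁ : Continuous f₁ := by fun_prop
  have hf₂ : Continuous f₂ := by fun_prop
  have hsplit : ∀ t : ℝ, ((t : ℂ) - z)⁻¹ = (f₁ t : ℂ) + (f₂ t : ℂ) * Complex.I := by
    intro t
    have h1 : ((t : ℂ) - z) * (((t - z.re : ℝ) : ℂ) + (z.im : ℂ) * Complex.I) =
        (((t - z.re) ^ 2 + z.im ^ 2 : ℝ) : ℂ) := by
      nth_rewrite 1 [← Complex.re_add_im z]
      push_cast
      linear_combination -(z.im : ℂ) ^ 2 * Complex.I_sq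
    have h2 : ((((t - z.re) ^ 2 + z.im ^ 2 : ℝ) : ℂ)) ≠ 0 := by exact_mod_cast hpos t
    rw [inv_eq_iff_eq_inv, eq_comm]
    apply inv_eq_of_mul_eq_one_left
    have h3 : (f₁ t : ℂ) + (f₂ t : ℂ) * Complex.I =
        (((t - z.re : ℝ) : ℂ) + (z.im : ℂ) * Complex.I) *
          ((((t - z.re) ^ 2 + z.im ^ 2 : ℝ) : ℂ))⁻¹ := by
      simp only [f₁, f₂, q, Complex.ofReal_mul, Complex.ofReal_inv]
      ring
    rw [h3, ← mul_assoc, h1, mul_inv_cancel₀ h2]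
  have hint : stieltjes (spectralMeasure T x) z =
      inner ℂ x (cfc f₁ T x) + inner ℂ x (cfc f₂ T x) * Complex.I := by
    rw [stieltjes, integral_congr_ae (Filter.Eventually.of_forall hsplit), integral_add,
      integral_mul_const, integral_complex_ofReal, integral_complex_ofReal,
      (spectralMeasure_facts hT x).2.2 f₁ hf₁, (spectralMeasure_facts hT x).2.2 f₂ hf₂]
    · rw [inner_cfc_self, inner_cfc_self]
    · exact hprob.integrable_of_continuous (by fun_prop)
    · exact hprob.integrable_of_continuous (by fun_prop)
  have hid : ∀ y : E, T y = cfc (fun t : ℝ => t) T y := fun y => by rw [cfc_id' ℝ T]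
  have hmul : ∀ f g : ℝ → ℝ, Continuous f → Continuous g → ∀ y : E,
      cfc f T (cfc g T y) = cfc (fun t => f t * g t) T y := fun f g hf hg y => by
    rw [cfc_mul f g T hf.continuousOn hg.continuousOn]; rfl
  have hcomb : ∀ (f g h : ℝ → ℝ) (r s : ℝ), Continuous f → Continuous g →
      (∀ t, h t = r * f t + s * g t) → ∀ y : E,
        cfc h T y = (r : ℂ) • cfc f T y + (s : ℂ) • cfc g T y := by
    intro f g h r s hf hg hh y
    rw [funext hh, cfc_add (a := T) (fun t => r * f t) (fun t => s * g t)
      (by fun_prop) (by fun_prop), cfc_const_mul r f T hf.continuousOn,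
      cfc_const_mul s g T hg.continuousOn, Complex.coe_smul, Complex.coe_smul]
    rfl
  have hres : Ring.inverse (T - z • (1 : E →L[ℂ] E)) x =
      cfc f₁ T x + Complex.I • cfc f₂ T x := by
    refine hT.inverse_apply_eq hz ?_
    rw [map_add, map_smul, hid, hid, hmul (fun t => t) f₁ continuous_id hf₁,
      hmul (fun t => t) f₂ continuous_id hf₂]
    -- `e1` and `e2` are the real and imaginary parts of `t (t - z)⁻¹ = 1 + z (t - z)⁻¹`.
    have e1 := hcomb f₁ f₂ (fun t => t * f₁ t - 1) z.re (-z.im) hf₁ hf₂ (fun t => by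
      simp only [f₁, f₂, q]
      have := hpos t
      field_simp
      ring) x
    have e2 := hcomb f₂ f₁ (fun t => t * f₂ t) z.re z.im hf₂ hf₁ (fun t => by
      simp only [f₁, f₂, q]
      ring) x
    have e3 := hcomb (fun t => t * f₁ t) (fun _ => 1) (fun t => t * f₁ t - 1) 1 (-1)
      (by fun_prop) (by fun_prop) (fun t => by ring) x
    rw [cfc_const_one ℝ T] at e3
    change _ = ((1 : ℝ) : ℂ) • cfc (fun t => t * f₁ t) T x + ((-1 : ℝ) : ℂ) • x at e3
    have e4 : cfc (fun t => t * f₁ t) T x =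
        (z.re : ℂ) • cfc f₁ T x + ((-z.im : ℝ) : ℂ) • cfc f₂ T x + x := by
      rw [← e1, e3]
      simp
    rw [e4, e2]
    have hz' : z = z.re + z.im * Complex.I := (Complex.re_add_im z).symm
    have hI : Complex.I * Complex.I = -1 := Complex.I_mul_I
    generalize cfc f₁ T x = A
    generalize cfc f₂ T x = B
    have : z • (A + Complex.I • B) = (z.re : ℂ) • A + ((z.im : ℂ) * Complex.I) • A +
        ((z.re : ℂ) * Complex.I) • B + ((-z.im : ℝ) : ℂ) • B := by
      conv_lhs => rw [hz']
      rw [smul_add, smul_smul, add_smul, add_mul, mul_assoc, hI, add_smul]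
      push_cast
      rw [mul_neg_one]
      abel
    rw [this, smul_add, smul_smul, smul_smul, mul_comm Complex.I, mul_comm Complex.I]
    abel
  rw [hint, hres, inner_add_right, inner_smul_right, mul_comm]

end SpectralMeasure

/-! ### Measurability of random measures from their moments. -/

section Measurability

variable {X : Type*} [MeasurableSpace X] {K : ℝ} {κ : X → Measure ℝ}

/-- On the common support `[-K, K]` a continuous function is a uniform limit of polynomials, by
Weierstrass. -/
theorem measurable_integral_of_moments (hκ : ∀ x, IsProbOn K (κ x))
    (hmom : ∀ n : ℕ, Measurable fun x => ∫ t, t ^ n ∂(κ x)) {f : ℝ → ℝ} (hf : Continuous f) :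
    Measurable fun x => ∫ t, f t ∂(κ x) := by
  have hex : ∀ n : ℕ, ∃ p : Polynomial ℝ, ∀ t ∈ Set.Icc (-K) K, |p.eval t - f t| < 1 / (n + 1 : ℝ) :=
    fun n => exists_polynomial_near_of_continuousOn (-K) K f hf.continuousOn _ (by positivity)
  choose p hp using hex
  refine measurable_of_tendsto_metrizable (f := fun n x => ∫ t, (p n).eval t ∂(κ x)) ?_ ?_
  · intro n
    have : (fun x => ∫ t, (p n).eval t ∂(κ x)) = fun x =>
        ∑ i ∈ Finset.range ((p n).natDegree + 1), (p n).coeff i * ∫ t, t ^ i ∂(κ x) := by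
      funext x
      simp_rw [Polynomial.eval_eq_sum_range]
      rw [integral_finsetSum]
      · simp_rw [integral_const_mul]
      · intro i _
        exact (hκ x).integrable_of_continuous (by fun_prop)
    rw [this]
    exact Finset.measurable_fun_sum _ fun i _ => (hmom i).const_mul _
  · rw [tendsto_pi_nhds]
    intro x
    have := (hκ x).1
    refine tendsto_iff_norm_sub_tendsto_zero.mpr (squeeze_zero (fun _ => norm_nonneg _) ?_
      tendsto_one_div_add_atTop_nhds_zero_nat)
    intro n
    rw [← integral_sub ((hκ x).integrable_of_continuous (p n).continuous)
      ((hκ x).integrable_of_continuous hf)]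
    refine (norm_integral_le_of_norm_le_const (C := 1 / (n + 1 : ℝ)) ?_).trans (by simp)
    filter_upwards [(hκ x).2] with t ht
    exact (hp n t (abs_le.mp ht)).le

/-- Closed half-lines form a π-system generating the Borel sets, and their indicators are limits of
continuous thickened indicators. Measurability of a spectral measure is thus reduced to that of
matrix entries of powers. -/
theorem measurable_of_moments (hκ : ∀ x, IsProbOn K (κ x))
    (hmom : ∀ n : ℕ, Measurable fun x => ∫ t, t ^ n ∂(κ x)) : Measurable κ := by
  have := fun x => (hκ x).1
  refine Measurable.measure_of_isPiSystem_of_isProbabilityMeasure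
    (BorelSpace.measurable_eq.trans (borel_eq_generateFrom_Iic ℝ)) isPiSystem_Iic ?_
  rintro _ ⟨s, rfl⟩
  have hpos : ∀ n : ℕ, (0 : ℝ) < 1 / (n + 1) := fun n => by positivity
  refine measurable_of_tendsto_metrizable (f := fun (n : ℕ) x =>
    ∫⁻ t, (thickenedIndicator (hpos n) (Set.Iic s) t : ENNReal) ∂(κ x)) ?_ ?_
  · intro n
    have hcont : Continuous fun t : ℝ => (thickenedIndicator (hpos n) (Set.Iic s) t : ℝ) :=
      NNReal.continuous_coe.comp (thickenedIndicator (hpos n) (Set.Iic s)).continuous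
    have : (fun x => ∫⁻ t, (thickenedIndicator (hpos n) (Set.Iic s) t : ENNReal) ∂(κ x)) =
        fun x => ENNReal.ofReal (∫ t, (thickenedIndicator (hpos n) (Set.Iic s) t : ℝ) ∂(κ x)) := by
      funext x
      rw [ofReal_integral_eq_lintegral_ofReal ((hκ x).integrable_of_continuous hcont)
        (Filter.Eventually.of_forall fun t => NNReal.coe_nonneg _)]
      simp
    rw [this]
    exact (measurable_integral_of_moments hκ hmom hcont).ennreal_ofReal
  · rw [tendsto_pi_nhds]
    intro x
    exact tendsto_lintegral_thickenedIndicator_of_isClosed (κ x) isClosed_Iic hpos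
      tendsto_one_div_add_atTop_nhds_zero_nat

end Measurability

/-! ### Stieltjes transforms on the upper half-plane. -/

section Stieltjes

variable {K : ℝ} {μ : Measure ℝ} {z : ℂ}

/-- The derivative `∫ (t - z)⁻² dμ(t)` of the Stieltjes transform. -/
noncomputable def stieltjesDeriv (μ : Measure ℝ) (z : ℂ) : ℂ := ∫ t : ℝ, (((t : ℂ) - z)⁻¹) ^ 2 ∂μ

theorem norm_inv_ofReal_sub_le (hz : 0 < z.im) (t : ℝ) : ‖((t : ℂ) - z)⁻¹‖ ≤ z.im⁻¹ := by
  rw [norm_inv]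
  refine inv_anti₀ hz ?_
  have := Complex.abs_im_le_norm ((t : ℂ) - z)
  simp only [Complex.sub_im, Complex.ofReal_im, zero_sub, abs_neg] at this
  exact (le_abs_self _).trans this

theorem IsProbOn.integrable_inv (hμ : IsProbOn K μ) (hz : 0 < z.im) :
    Integrable (fun t : ℝ => ((t : ℂ) - z)⁻¹) μ :=
  hμ.integrable_of_continuous (continuous_inv_ofReal_sub hz.ne')

theorem IsProbOn.norm_stieltjes_le (hμ : IsProbOn K μ) (hz : 0 < z.im) :
    ‖stieltjes μ z‖ ≤ z.im⁻¹ := by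
  have := hμ.1
  refine (norm_integral_le_of_norm_le_const (C := z.im⁻¹) ?_).trans (by simp)
  exact Filter.Eventually.of_forall fun t => norm_inv_ofReal_sub_le hz t

theorem IsProbOn.norm_stieltjesDeriv_le (hμ : IsProbOn K μ) (hz : 0 < z.im) :
    ‖stieltjesDeriv μ z‖ ≤ (z.im⁻¹) ^ 2 := by
  have := hμ.1
  refine (norm_integral_le_of_norm_le_const (C := (z.im⁻¹) ^ 2) ?_).trans (by simp)
  refine Filter.Eventually.of_forall fun t => ?_
  rw [norm_pow]
  exact pow_le_pow_left₀ (norm_nonneg _) (norm_inv_ofReal_sub_le hz t) 2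

/-- `Im (t - z)⁻¹ = Im z / |t - z|²` and `|t - z| ≤ K + ‖z‖` on the support. The bound does not
depend on the measure; it keeps the transform off the branch cut and its logarithm bounded. -/
theorem IsProbOn.le_im_stieltjes (hμ : IsProbOn K μ) (hz : 0 < z.im) :
    z.im / (K + ‖z‖) ^ 2 ≤ (stieltjes μ z).im := by
  have := hμ.1
  have hint := hμ.integrable_inv hz
  have him : (stieltjes μ z).im = ∫ t : ℝ, (((t : ℂ) - z)⁻¹).im ∂μ := (integral_im hint).symm
  have hconst : z.im / (K + ‖z‖) ^ 2 = ∫ _ : ℝ, z.im / (K + ‖z‖) ^ 2 ∂μ := by simp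
  rw [him, hconst]
  refine integral_mono_ae (integrable_const _) hint.im ?_
  filter_upwards [hμ.2] with t ht
  change z.im / (K + ‖z‖) ^ 2 ≤ (((t : ℂ) - z)⁻¹).im
  rw [Complex.inv_im]
  simp only [Complex.sub_im, Complex.ofReal_im, zero_sub, neg_neg]
  refine div_le_div_of_nonneg_left hz.le (Complex.normSq_pos.mpr (ofReal_sub_ne_zero hz.ne' t)) ?_
  rw [Complex.normSq_eq_norm_sq]
  refine pow_le_pow_left₀ (norm_nonneg _) ((norm_sub_le _ _).trans ?_) 2
  simpa using ht

theorem IsProbOn.im_stieltjes_pos (hμ : IsProbOn K μ) (hK : 0 ≤ K) (hz : 0 < z.im) :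
    0 < (stieltjes μ z).im := by
  refine lt_of_lt_of_le ?_ (hμ.le_im_stieltjes hz)
  have : 0 < ‖z‖ := norm_pos_iff.mpr fun h => by simp [h] at hz
  positivity

theorem IsProbOn.stieltjes_ne_zero (hμ : IsProbOn K μ) (hK : 0 ≤ K) (hz : 0 < z.im) :
    stieltjes μ z ≠ 0 := fun h => by
  have := hμ.im_stieltjes_pos hK hz
  simp [h] at this

theorem hasDerivAt_inv_ofReal_sub (hz : z.im ≠ 0) (t : ℝ) :
    HasDerivAt (fun w : ℂ => ((t : ℂ) - w)⁻¹) ((((t : ℂ) - z)⁻¹) ^ 2) z := by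
  have h1 : HasDerivAt (fun w : ℂ => (t : ℂ) - w) (-1) z := by
    simpa using (hasDerivAt_id z).const_sub (t : ℂ)
  exact (h1.inv (ofReal_sub_ne_zero hz t)).congr_deriv (by rw [neg_neg, inv_pow, one_div])

theorem im_half_nhds (hz : 0 < z.im) :
    {w : ℂ | z.im / 2 < w.im} ∩ {w : ℂ | ‖w‖ < ‖z‖ + 1} ∈ nhds z :=
  ((isOpen_lt continuous_const Complex.continuous_im).inter
    (isOpen_lt continuous_norm continuous_const)).mem_nhds
      ⟨by simpa using hz, by simp⟩

theorem IsProbOn.hasDerivAt_stieltjes (hμ : IsProbOn K μ) (hz : 0 < z.im) :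
    HasDerivAt (stieltjes μ) (stieltjesDeriv μ z) z := by
  have := hμ.1
  refine (hasDerivAt_integral_of_dominated_loc_of_deriv_le
    (bound := fun _ => ((z.im / 2)⁻¹) ^ 2) (F := fun w (t : ℝ) => ((t : ℂ) - w)⁻¹)
    (F' := fun w t => (((t : ℂ) - w)⁻¹) ^ 2) (im_half_nhds hz) ?_ (hμ.integrable_inv hz)
    ?_ ?_ (integrable_const _) ?_).2
  · filter_upwards [im_half_nhds hz] with w hw
    exact (hμ.integrable_inv (lt_trans (half_pos hz) hw.1)).aestronglyMeasurable
  · exact ((continuous_inv_ofReal_sub hz.ne').pow 2).aestronglyMeasurable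
  · refine Filter.Eventually.of_forall fun t w hw => ?_
    rw [norm_pow]
    refine pow_le_pow_left₀ (norm_nonneg _)
      ((norm_inv_ofReal_sub_le (lt_trans (half_pos hz) hw.1) t).trans ?_) 2
    exact inv_anti₀ (half_pos hz) hw.1.le
  · exact Filter.Eventually.of_forall fun t w hw =>
      hasDerivAt_inv_ofReal_sub (lt_trans (half_pos hz) hw.1).ne' t

theorem isProbOn_dirac {t : ℝ} (ht : |t| ≤ K) : IsProbOn K (Measure.dirac t) :=
  ⟨inferInstance, by rwa [ae_dirac_eq]⟩

theorem stieltjes_dirac (t : ℝ) (z : ℂ) : stieltjes (Measure.dirac t) z = ((t : ℂ) - z)⁻¹ := by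
  rw [stieltjes, integral_dirac]

theorem stieltjesDeriv_dirac (t : ℝ) (z : ℂ) :
    stieltjesDeriv (Measure.dirac t) z = (((t : ℂ) - z)⁻¹) ^ 2 := by
  rw [stieltjesDeriv, integral_dirac]

/-- This puts the density-of-states side into the same form as the other two: the logarithm of the
transform of a random measure, here `δ_t` with `t` drawn from `dk`. Since `t - z` is off the
negative axis, inversion respects the principal branch. -/
theorem log_ofReal_sub_eq (hz : 0 < z.im) (t : ℝ) :
    Complex.log ((t : ℂ) - z) = -Complex.log (stieltjes (Measure.dirac t) z) := by
  rw [stieltjes_dirac, Complex.log_inv, neg_neg]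
  intro h
  have := Complex.arg_eq_pi_iff.mp h
  simp at this
  linarith [this.2]

/-- At `z = iy` the transform times `-z` is `1 - ∫ t (t - z)⁻¹ dμ`, within `K / y ≤ 1/2` of `1`, and
`‖log (1 + w)‖ ≤ (3/2) ‖w‖` for `‖w‖ ≤ 1/2`. The principal logarithms add, since the arguments lie
in `[0, π]` and at `-π/2`. -/
theorem IsProbOn.norm_log_stieltjes_add_log_le (hμ : IsProbOn K μ) (hK : 0 ≤ K) {y : ℝ}
    (hy : 0 < y) (hKy : 2 * K ≤ y) :
    ‖Complex.log (stieltjes μ (y * Complex.I)) + Complex.log (-(y * Complex.I))‖ ≤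
      3 / 2 * K / y := by
  have := hμ.1
  set z : ℂ := y * Complex.I with hzdef
  have hzim : z.im = y := by simp [hzdef]
  have hz : 0 < z.im := by rwa [hzim]
  have hz0 : z ≠ 0 := fun h => by simp [h] at hz
  have hSne := hμ.stieltjes_ne_zero hK hz
  have harg : (-z).arg = -(Real.pi / 2) := by
    have : -z = y * (-Complex.I) := by rw [hzdef]; ring
    rw [this, Complex.arg_real_mul _ hy, Complex.arg_neg_I]
  have hargS : 0 ≤ (stieltjes μ z).arg :=
    Complex.arg_nonneg_iff.mpr (hμ.im_stieltjes_pos hK hz).le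
  have hargS' := Complex.arg_le_pi (stieltjes μ z)
  have hpi := Real.pi_pos
  rw [← Complex.log_mul hSne (neg_ne_zero.mpr hz0)
    ⟨by rw [harg]; linarith, by rw [harg]; linarith⟩]
  have hw : stieltjes μ z * -z = 1 + ∫ t : ℝ, -((t : ℂ) * ((t : ℂ) - z)⁻¹) ∂μ := by
    have h1 : (1 : ℂ) = ∫ _ : ℝ, (1 : ℂ) ∂μ := by simp
    rw [stieltjes, ← integral_mul_const, h1, ← integral_add (integrable_const _)]
    · refine integral_congr_ae (Filter.Eventually.of_forall fun t => ?_)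
      have := ofReal_sub_ne_zero hz.ne' t
      simp only
      field_simp
      ring
    · exact hμ.integrable_of_continuous
        ((Complex.continuous_ofReal.mul (continuous_inv_ofReal_sub hz.ne')).neg)
  have hwn : ‖∫ t : ℝ, -((t : ℂ) * ((t : ℂ) - z)⁻¹) ∂μ‖ ≤ K / y := by
    refine (norm_integral_le_of_norm_le_const (C := K / y) ?_).trans (by simp)
    filter_upwards [hμ.2] with t ht
    rw [norm_neg, norm_mul, Complex.norm_real, div_eq_mul_inv, ← hzim]
    exact mul_le_mul ht (norm_inv_ofReal_sub_le hz t) (norm_nonneg _) hK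
  rw [hw]
  refine (Complex.norm_log_one_add_half_le_self (hwn.trans ?_)).trans ?_
  · rw [div_le_iff₀ hy]
    linarith
  · rw [mul_div_assoc]
    exact mul_le_mul_of_nonneg_left hwn (by norm_num)

/-! ### Expected logarithms of random Stieltjes transforms. -/

section Random

variable {X : Type*} [MeasurableSpace X] {ν : Measure X} {κ : X → Measure ℝ}

theorem measurable_stieltjes (hκ : Measurable κ) (hz : z.im ≠ 0) :
    Measurable fun x => stieltjes (κ x) z :=
  (StronglyMeasurable.integral_kernel (κ := (⟨κ, hκ⟩ : Kernel X ℝ))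
    (continuous_inv_ofReal_sub hz).stronglyMeasurable).measurable

theorem measurable_stieltjesDeriv (hκ : Measurable κ) (hz : z.im ≠ 0) :
    Measurable fun x => stieltjesDeriv (κ x) z :=
  (StronglyMeasurable.integral_kernel (κ := (⟨κ, hκ⟩ : Kernel X ℝ))
    ((continuous_inv_ofReal_sub hz).pow 2).stronglyMeasurable).measurable

variable [IsProbabilityMeasure ν]

theorem integrable_log_stieltjes (hκ : Measurable κ) (hK : 0 ≤ K)
    (hprob : ∀ᵐ x ∂ν, IsProbOn K (κ x)) (hz : 0 < z.im) :
    Integrable (fun x => Complex.log (stieltjes (κ x) z)) ν := by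
  have hzn : 0 < ‖z‖ := norm_pos_iff.mpr fun h => by simp [h] at hz
  have hlo : 0 < z.im / (K + ‖z‖) ^ 2 := by positivity
  refine Integrable.of_bound
    (Complex.measurable_log.comp (measurable_stieltjes hκ hz.ne')).aestronglyMeasurable
    (max |Real.log (z.im / (K + ‖z‖) ^ 2)| |Real.log z.im⁻¹| + Real.pi) ?_
  filter_upwards [hprob] with x hx
  refine (Complex.norm_le_abs_re_add_abs_im _).trans (add_le_add ?_ ?_)
  · rw [Complex.log_re]
    have h1 : z.im / (K + ‖z‖) ^ 2 ≤ ‖stieltjes (κ x) z‖ :=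
      (hx.le_im_stieltjes hz).trans ((le_abs_self _).trans (Complex.abs_im_le_norm _))
    exact abs_le_max_abs_abs (Real.log_le_log hlo h1)
      (Real.log_le_log (hlo.trans_le h1) (hx.norm_stieltjes_le hz))
  · rw [Complex.log_im]
    exact Complex.abs_arg_le_pi _

theorem norm_logDeriv_stieltjes_le {r R : ℝ} (hr : 0 < r) (hK : 0 ≤ K) {w : ℂ} (hw : r < w.im)
    (hR : ‖w‖ < R) (hμ : IsProbOn K μ) :
    ‖stieltjesDeriv μ w / stieltjes μ w‖ ≤ (r⁻¹) ^ 2 / (r / (K + R) ^ 2) := by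
  have hw0 : 0 < w.im := hr.trans hw
  have hwn : 0 < ‖w‖ := norm_pos_iff.mpr fun h => by simp [h] at hw0
  have hR0 : 0 < R := hwn.trans hR
  rw [norm_div]
  refine div_le_div₀ (by positivity) ?_ (by positivity) ?_
  · exact (hμ.norm_stieltjesDeriv_le hw0).trans
      (pow_le_pow_left₀ (inv_nonneg.mpr hw0.le) (inv_anti₀ hr hw.le) 2)
  · refine le_trans ?_ ((hμ.le_im_stieltjes hw0).trans
      ((le_abs_self _).trans (Complex.abs_im_le_norm _)))
    exact div_le_div₀ hw0.le hw.le (by positivity)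
      (pow_le_pow_left₀ (by positivity) (by linarith) 2)

/-- Differentiation under the expectation: near `z` the logarithmic derivative has a deterministic
bound, and a positive imaginary part keeps the transform in the domain of the principal branch. -/
theorem hasDerivAt_integral_log_stieltjes (hκ : Measurable κ) (hK : 0 ≤ K)
    (hprob : ∀ᵐ x ∂ν, IsProbOn K (κ x)) (hz : 0 < z.im) :
    HasDerivAt (fun w => ∫ x, Complex.log (stieltjes (κ x) w) ∂ν)
      (∫ x, stieltjesDeriv (κ x) z / stieltjes (κ x) z ∂ν) z := by
  refine (hasDerivAt_integral_of_dominated_loc_of_deriv_le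
    (bound := fun _ => ((z.im / 2)⁻¹) ^ 2 / ((z.im / 2) / (K + (‖z‖ + 1)) ^ 2))
    (F := fun w x => Complex.log (stieltjes (κ x) w))
    (F' := fun w x => stieltjesDeriv (κ x) w / stieltjes (κ x) w) (im_half_nhds hz) ?_
    (integrable_log_stieltjes hκ hK hprob hz) ?_ ?_ (integrable_const _) ?_).2
  · filter_upwards [im_half_nhds hz] with w hw
    exact (integrable_log_stieltjes hκ hK hprob
      (lt_trans (half_pos hz) hw.1)).aestronglyMeasurable
  · exact ((measurable_stieltjesDeriv hκ hz.ne').div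
      (measurable_stieltjes hκ hz.ne')).aestronglyMeasurable
  · filter_upwards [hprob] with x hx w hw
    exact norm_logDeriv_stieltjes_le (half_pos hz) hK hw.1 hw.2 hx
  · filter_upwards [hprob] with x hx w hw
    have hw0 : 0 < w.im := lt_trans (half_pos hz) hw.1
    exact (hx.hasDerivAt_stieltjes hw0).clog (Or.inr (hx.im_stieltjes_pos hK hw0).ne')

theorem norm_integral_log_stieltjes_add_log_le (hκ : Measurable κ) (hK : 0 ≤ K)
    (hprob : ∀ᵐ x ∂ν, IsProbOn K (κ x)) {y : ℝ} (hy : 0 < y) (hKy : 2 * K ≤ y) :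
    ‖(∫ x, Complex.log (stieltjes (κ x) (y * Complex.I)) ∂ν) + Complex.log (-(y * Complex.I))‖ ≤
      3 / 2 * K / y := by
  have h1 : Complex.log (-(y * Complex.I)) = ∫ _ : X, Complex.log (-(y * Complex.I)) ∂ν := by simp
  rw [h1, ← integral_add
    (integrable_log_stieltjes hκ hK hprob (by simpa using hy)) (integrable_const _)]
  refine (norm_integral_le_of_norm_le_const (C := 3 / 2 * K / y) ?_).trans (by simp)
  filter_upwards [hprob] with x hx
  exact hx.norm_log_stieltjes_add_log_le hK hy hKy

end Random

/-- A linear combination of functions on the upper half-plane, all asymptotic to `-log (-z)`,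
vanishes if its coefficients add up to zero and its derivative vanishes. -/
theorem linearCombination_eq_zero_of_deriv {f g h f' g' h' : ℂ → ℂ} {B : ℝ} {α β γ : ℂ}
    (hf : ∀ z : ℂ, 0 < z.im → HasDerivAt f (f' z) z)
    (hg : ∀ z : ℂ, 0 < z.im → HasDerivAt g (g' z) z)
    (hh : ∀ z : ℂ, 0 < z.im → HasDerivAt h (h' z) z)
    (hf0 : ∀ y : ℝ, 0 < y → B ≤ y → ‖f (y * Complex.I) + Complex.log (-(y * Complex.I))‖ ≤ B / y)
    (hg0 : ∀ y : ℝ, 0 < y → B ≤ y → ‖g (y * Complex.I) + Complex.log (-(y * Complex.I))‖ ≤ B / y)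
    (hh0 : ∀ y : ℝ, 0 < y → B ≤ y → ‖h (y * Complex.I) + Complex.log (-(y * Complex.I))‖ ≤ B / y)
    (hsum : α + β + γ = 0)
    (hderiv : ∀ z : ℂ, 0 < z.im → α * f' z + β * g' z + γ * h' z = 0) (hz : 0 < z.im) :
    α * f z + β * g z + γ * h z = 0 := by
  let U : Set ℂ := {w | 0 < w.im}
  have hU : IsOpen U := isOpen_lt continuous_const Complex.continuous_im
  have hD : ∀ w ∈ U, HasDerivAt (fun w => α * f w + β * g w + γ * h w) 0 w := fun w hw => by
    rw [← hderiv w hw]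
    exact (((hf w hw).const_mul α).add ((hg w hw).const_mul β)).add ((hh w hw).const_mul γ)
  have hconst : ∀ y : ℝ, 0 < y → α * f z + β * g z + γ * h z = α * f (y * Complex.I) +
      β * g (y * Complex.I) + γ * h (y * Complex.I) := fun y hy =>
    hU.is_const_of_deriv_eq_zero (convex_halfSpace_im_gt 0).isPreconnected
      (fun w hw => (hD w hw).differentiableAt.differentiableWithinAt)
      (fun w hw => (hD w hw).deriv) (show z ∈ U from hz)
      (show ((y : ℂ) * Complex.I) ∈ U by simpa [U] using hy)
  have hbound : ∀ᶠ y : ℝ in Filter.atTop,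
      ‖α * f z + β * g z + γ * h z‖ ≤ (‖α‖ + ‖β‖ + ‖γ‖) * B / y := by
    filter_upwards [Filter.eventually_gt_atTop 0, Filter.eventually_ge_atTop B] with y hy hB
    rw [hconst y hy]
    -- The combination is constant on the half-plane. Adding `L` to each function costs nothing
    -- because the coefficients sum to zero, and each term is then `O(1/y)`.
    set L := Complex.log (-(y * Complex.I))
    have : α * f (y * Complex.I) + β * g (y * Complex.I) + γ * h (y * Complex.I) =
        α * (f (y * Complex.I) + L) + β * (g (y * Complex.I) + L) + γ * (h (y * Complex.I) + L) := by
      linear_combination -L * hsum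
    rw [this, mul_div_assoc, add_mul, add_mul]
    refine (norm_add₃_le).trans ?_
    rw [norm_mul, norm_mul, norm_mul]
    gcongr
    · exact hf0 y hy hB
    · exact hg0 y hy hB
    · exact hh0 y hy hB
  have hlim := ge_of_tendsto
    ((tendsto_const_nhds (x := (‖α‖ + ‖β‖ + ‖γ‖) * B)).div_atTop Filter.tendsto_id) hbound
  exact norm_le_zero_iff.mp hlim

end Stieltjes

/-! ### Jacobi operators with truncated parameters. -/

section RandomOperator

variable {V : Type*} {G : SimpleGraph V}

/-- By induction on `n`, the entries of `T ^ n δ_u` are finite sums of products of parameters; their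
values at `u` give the moments. -/
theorem measurable_spectralMeasure_jacobiOperator [G.LocallyFinite] {X : Type*}
    [MeasurableSpace X] {D : ℕ} (hD : ∀ u, (G.neighborSet u).encard ≤ D) {C : ℝ} (hC : 0 ≤ C)
    {a : X → G.edgeSet → ℝ} {b : X → V → ℝ} (ha : ∀ x e, |a x e| ≤ C) (hb : ∀ x u, |b x u| ≤ C)
    (ham : ∀ e, Measurable fun x => a x e) (hbm : ∀ u, Measurable fun x => b x u) (u : V) :
    Measurable fun x => spectralMeasure (jacobiOperator G (a x) (b x)) (deltaVec u) := by
  have hs := fun x => jacobiOperator_isSelfAdjoint hD hC (ha x) (hb x)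
  have hJ := fun x => jacobiOperator_spec D hD C hC (ha x) (hb x)
  refine measurable_of_moments (K := C * (D + 1)) (fun x => isProbOn_spectralMeasure (hs x)
    (norm_deltaVec u) ((hJ x).norm_le D hD C hC (ha x) (hb x))) fun n => ?_
  have hpow : ∀ n : ℕ, ∀ w, Measurable fun x =>
      ((jacobiOperator G (a x) (b x) ^ n) (deltaVec u) : EllTwo V) w := by
    intro n
    induction n with
    | zero =>
      intro w
      exact measurable_const
    | succ n ih =>
      intro w
      have : ∀ x, ((jacobiOperator G (a x) (b x) ^ (n + 1)) (deltaVec u) : EllTwo V) w =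
          (b x w : ℂ) * ((jacobiOperator G (a x) (b x) ^ n) (deltaVec u) : EllTwo V) w +
            ∑ v : G.neighborSet w, (a x ⟨s(w, (v : V)), v.2⟩ : ℂ) *
              ((jacobiOperator G (a x) (b x) ^ n) (deltaVec u) : EllTwo V) v := fun x => by
        rw [pow_succ', ← finsum_eq_sum_of_fintype]
        exact hJ x _ w
      simp_rw [this]
      refine ((Complex.measurable_ofReal.comp (hbm w)).mul (ih w)).add
        (Finset.measurable_fun_sum _ fun v _ => ?_)
      exact (Complex.measurable_ofReal.comp (ham _)).mul (ih v)
  simp_rw [fun x => integral_pow_spectralMeasure (hs x) (deltaVec u) n, inner_deltaVec]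
  exact Complex.measurable_re.comp (hpow n u)

/-- Truncation of a real number to `[-M, M]`. -/
def truncate (M x : ℝ) : ℝ := max (-M) (min M x)

theorem abs_truncate_le {M : ℝ} (hM : 0 ≤ M) (x : ℝ) : |truncate M x| ≤ M :=
  abs_le.mpr ⟨le_max_left _ _, max_le (by linarith) (min_le_left _ _)⟩

theorem truncate_eq {M x : ℝ} (hx : |x| ≤ M) : truncate M x = x := by
  rw [truncate, min_eq_right (abs_le.mp hx).2, max_eq_right (abs_le.mp hx).1]

theorem measurable_truncate (M : ℝ) : Measurable (truncate M) :=
  measurable_const.max (measurable_const.min measurable_id)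

variable (G) in
/-- The spectral measure at `u` of the Jacobi operator with the parameters `p`, truncated at `M`. -/
noncomputable def vertexMeasure (M : ℝ) (u : V) (p : G.edgeSet ⊕ V → ℝ) : Measure ℝ :=
  spectralMeasure (jacobiOperator G (fun e => truncate M (p (.inl e)))
    (fun v => truncate M (p (.inr v)))) (deltaVec u)

variable (G) in
/-- The spectral measure at `v` of the Jacobi operator with the parameters `p`, truncated at `M`,
and with the edge `e` removed. -/
noncomputable def cutMeasure (M : ℝ) (e : G.edgeSet) (v : V) (p : G.edgeSet ⊕ V → ℝ) : Measure ℝ :=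
  spectralMeasure (jacobiOperator G (removeEdge (fun e => truncate M (p (.inl e))) e)
    (fun v => truncate M (p (.inr v)))) (deltaVec v)

section Deterministic

variable {D : ℕ} {M : ℝ} {z : ℂ}

theorem measurable_vertexMeasure [G.LocallyFinite] (hD : ∀ u, (G.neighborSet u).encard ≤ D)
    (hM : 0 ≤ M) (u : V) : Measurable (vertexMeasure G M u) :=
  measurable_spectralMeasure_jacobiOperator hD hM (fun _ _ => abs_truncate_le hM _)
    (fun _ _ => abs_truncate_le hM _)
    (fun _ => (measurable_truncate M).comp (measurable_pi_apply _))
    (fun _ => (measurable_truncate M).comp (measurable_pi_apply _)) u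

theorem measurable_cutMeasure [G.LocallyFinite] (hD : ∀ u, (G.neighborSet u).encard ≤ D)
    (hM : 0 ≤ M) (e : G.edgeSet) (v : V) : Measurable (cutMeasure G M e v) := by
  refine measurable_spectralMeasure_jacobiOperator hD hM
    (fun _ _ => abs_removeEdge_le hM (fun _ => abs_truncate_le hM _) _ _)
    (fun _ _ => abs_truncate_le hM _) (fun f => ?_)
    (fun _ => (measurable_truncate M).comp (measurable_pi_apply _)) v
  by_cases h : f = e
  · simp_rw [h, removeEdge_self]
    exact measurable_const
  · simp_rw [fun p : G.edgeSet ⊕ V → ℝ =>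
      removeEdge_of_ne (fun e => truncate M (p (.inl e))) h]
    exact (measurable_truncate M).comp (measurable_pi_apply _)

theorem isProbOn_jacobi (hD : ∀ u, (G.neighborSet u).encard ≤ D) (hM : 0 ≤ M)
    {a : G.edgeSet → ℝ} {b : V → ℝ} (ha : ∀ e, |a e| ≤ M) (hb : ∀ v, |b v| ≤ M) (u : V) :
    IsProbOn (M * (D + 1)) (spectralMeasure (jacobiOperator G a b) (deltaVec u)) :=
  isProbOn_spectralMeasure (jacobiOperator_isSelfAdjoint hD hM ha hb) (norm_deltaVec u)
    ((jacobiOperator_spec D hD M hM ha hb).norm_le D hD M hM ha hb)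

theorem isProbOn_vertexMeasure (hD : ∀ u, (G.neighborSet u).encard ≤ D) (hM : 0 ≤ M) (u : V)
    (p : G.edgeSet ⊕ V → ℝ) : IsProbOn (M * (D + 1)) (vertexMeasure G M u p) :=
  isProbOn_jacobi hD hM (fun _ => abs_truncate_le hM _) (fun _ => abs_truncate_le hM _) u

theorem isProbOn_cutMeasure (hD : ∀ u, (G.neighborSet u).encard ≤ D) (hM : 0 ≤ M) (e : G.edgeSet)
    (v : V) (p : G.edgeSet ⊕ V → ℝ) : IsProbOn (M * (D + 1)) (cutMeasure G M e v p) :=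
  isProbOn_jacobi hD hM (fun _ => abs_removeEdge_le hM (fun _ => abs_truncate_le hM _) _ _)
    (fun _ => abs_truncate_le hM _) v

theorem stieltjes_jacobi (hD : ∀ u, (G.neighborSet u).encard ≤ D) (hM : 0 ≤ M)
    {a : G.edgeSet → ℝ} {b : V → ℝ} (ha : ∀ e, |a e| ≤ M) (hb : ∀ v, |b v| ≤ M) (u : V)
    (hz : z.im ≠ 0) : stieltjes (spectralMeasure (jacobiOperator G a b) (deltaVec u)) z =
      greenFunction (jacobiOperator G a b) u z :=
  stieltjes_spectralMeasure (jacobiOperator_isSelfAdjoint hD hM ha hb) (norm_deltaVec u) hz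

theorem stieltjes_vertexMeasure (hD : ∀ u, (G.neighborSet u).encard ≤ D) (hM : 0 ≤ M) (u : V)
    (p : G.edgeSet ⊕ V → ℝ) (hz : z.im ≠ 0) : stieltjes (vertexMeasure G M u p) z =
      greenFunction (jacobiOperator G (fun e => truncate M (p (.inl e)))
        (fun v => truncate M (p (.inr v)))) u z :=
  stieltjes_jacobi hD hM (fun _ => abs_truncate_le hM _) (fun _ => abs_truncate_le hM _) u hz

theorem stieltjes_cutMeasure (hD : ∀ u, (G.neighborSet u).encard ≤ D) (hM : 0 ≤ M) (e : G.edgeSet)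
    (v : V) (p : G.edgeSet ⊕ V → ℝ) (hz : z.im ≠ 0) : stieltjes (cutMeasure G M e v p) z =
      greenFunction (jacobiOperator G (removeEdge (fun e => truncate M (p (.inl e))) e)
        (fun v => truncate M (p (.inr v)))) v z :=
  stieltjes_jacobi hD hM (fun _ => abs_removeEdge_le hM (fun _ => abs_truncate_le hM _) _ _)
    (fun _ => abs_truncate_le hM _) v hz

/-- The edge comes with an equation for its endpoints, so that the identity can be used from both
ends with the same element `e`. -/
theorem stieltjes_edge [G.LocallyFinite] (hG : G.IsAcyclic)
    (hD : ∀ u, (G.neighborSet u).encard ≤ D) (hM : 0 ≤ M) (hz : z.im ≠ 0) {u v : V}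
    (e : G.edgeSet) (he : (e : Sym2 V) = s(u, v)) (p : G.edgeSet ⊕ V → ℝ) :
    stieltjes (vertexMeasure G M u p) z = stieltjes (cutMeasure G M e u p) z *
      (1 + (truncate M (p (.inl e)) : ℂ) ^ 2 * stieltjes (vertexMeasure G M u p) z *
        stieltjes (cutMeasure G M e v p) z) := by
  obtain ⟨_, h⟩ := e
  obtain rfl : _ = s(u, v) := he
  rw [stieltjes_vertexMeasure hD hM _ _ hz, stieltjes_cutMeasure hD hM _ _ _ hz,
    stieltjes_cutMeasure hD hM _ _ _ hz]
  obtain ⟨h1, h2⟩ := greenVec_edge (a := fun e => truncate M (p (.inl e)))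
    (b := fun v => truncate M (p (.inr v))) hG hD hM (fun _ => abs_truncate_le hM _)
    (fun _ => abs_truncate_le hM _) hz (show G.Adj u v from h)
  rw [h1] at h2
  refine h2.trans ?_
  ring

theorem stieltjes_vertex [G.LocallyFinite] (hG : G.IsAcyclic)
    (hD : ∀ u, (G.neighborSet u).encard ≤ D) (hM : 0 ≤ M) (hz : z.im ≠ 0) (u : V)
    (p : G.edgeSet ⊕ V → ℝ) :
    stieltjes (vertexMeasure G M u p) z * (truncate M (p (.inr u)) - z - ∑ v : G.neighborSet u,
      (truncate M (p (.inl ⟨s(u, (v : V)), v.2⟩)) : ℂ) ^ 2 *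
        stieltjes (cutMeasure G M ⟨s(u, (v : V)), v.2⟩ v p) z) = 1 := by
  rw [stieltjes_vertexMeasure hD hM _ _ hz,
    Finset.sum_congr rfl fun v _ => by rw [stieltjes_cutMeasure hD hM _ _ _ hz]]
  exact greenFunction_vertex hG hD hM (fun _ => abs_truncate_le hM _)
    (fun _ => abs_truncate_le hM _) hz u

theorem eventually_im_pos (hz : 0 < z.im) : ∀ᶠ w : ℂ in nhds z, 0 < w.im :=
  (isOpen_lt continuous_const Complex.continuous_im).mem_nhds hz

/-- This is the logarithmic derivative of `G_u / m_u = 1 / (1 - a² m_u m_v)`. The same denominator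
turns `m_u` into `G_u` and `m_v` into `G_v`, so the two terms on the right are exchanged by
reversing the edge and will have equal expectations. -/
theorem logDeriv_stieltjes_edge [G.LocallyFinite] (hG : G.IsAcyclic)
    (hD : ∀ u, (G.neighborSet u).encard ≤ D) (hM : 0 ≤ M) (hz : 0 < z.im) {u v : V}
    (e : G.edgeSet) (he : (e : Sym2 V) = s(u, v)) (p : G.edgeSet ⊕ V → ℝ) :
    stieltjesDeriv (vertexMeasure G M u p) z / stieltjes (vertexMeasure G M u p) z -
        stieltjesDeriv (cutMeasure G M e u p) z / stieltjes (cutMeasure G M e u p) z =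
      (truncate M (p (.inl e)) : ℂ) ^ 2 * stieltjesDeriv (cutMeasure G M e v p) z *
          stieltjes (vertexMeasure G M u p) z +
        (truncate M (p (.inl e)) : ℂ) ^ 2 * stieltjesDeriv (cutMeasure G M e u p) z *
          stieltjes (vertexMeasure G M v p) z := by
  have hK : 0 ≤ M * (D + 1) := by positivity
  have hgu := isProbOn_vertexMeasure hD hM u p
  have hmu := isProbOn_cutMeasure hD hM e u p
  have hmv := isProbOn_cutMeasure hD hM e v p
  have E1 := stieltjes_edge hG hD hM hz.ne' e he p
  have E2 := stieltjes_edge hG hD hM hz.ne' e (he.trans Sym2.eq_swap) p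
  have hgu0 := hgu.stieltjes_ne_zero hK hz
  have hmu0 := hmu.stieltjes_ne_zero hK hz
  have hinv : (fun w => (stieltjes (cutMeasure G M e u p) w)⁻¹) =ᶠ[nhds z] fun w =>
      (stieltjes (vertexMeasure G M u p) w)⁻¹ +
        (truncate M (p (.inl e)) : ℂ) ^ 2 * stieltjes (cutMeasure G M e v p) w := by
    filter_upwards [eventually_im_pos hz] with w hw
    have h0 := hgu.stieltjes_ne_zero hK hw
    have h1 := hmu.stieltjes_ne_zero hK hw
    have h2 := stieltjes_edge hG hD hM hw.ne' e he p
    field_simp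
    linear_combination h2
  have hder := (((hgu.hasDerivAt_stieltjes hz).inv hgu0).add
    ((hmv.hasDerivAt_stieltjes hz).const_mul ((truncate M (p (.inl e)) : ℂ) ^ 2))).unique
      (((hmu.hasDerivAt_stieltjes hz).inv hmu0).congr_of_eventuallyEq hinv.symm)
  generalize stieltjes (vertexMeasure G M u p) z = gu at *
  generalize stieltjes (vertexMeasure G M v p) z = gv at *
  generalize stieltjes (cutMeasure G M e u p) z = mu at *
  generalize stieltjes (cutMeasure G M e v p) z = mv at *
  generalize stieltjesDeriv (vertexMeasure G M u p) z = gu' at *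
  generalize stieltjesDeriv (cutMeasure G M e u p) z = mu' at *
  generalize stieltjesDeriv (cutMeasure G M e v p) z = mv' at *
  generalize ((truncate M (p (.inl e)) : ℂ) ^ 2) = α at *
  -- Both sides equal `gu * gv * (1 - α * mu * mv)`, by the edge identity from either end.
  have hsym : gu * mv = gv * mu := by
    have h3 : gu * (1 - α * mu * mv) = mu := by linear_combination E1
    have h4 : gv * (1 - α * mu * mv) = mv := by linear_combination E2
    linear_combination gv * h3 - gu * h4
  have hgu' : gu' / gu = gu / mu * (mu' / mu) + α * mv' * gu := by
    field_simp at hder ⊢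
    linear_combination -hder
  have hratio : gu / mu = 1 + α * gu * mv := by
    field_simp
    linear_combination E1
  have hgv : gv = gu * mv / mu := by
    field_simp
    exact hsym.symm
  rw [hgu', hratio, hgv]
  ring

/-- Differentiate `1/G_u = b_u - z - ∑ a² m_v` and multiply by `-G_u`; the isolated `G_u` comes from
the derivative of `-z`. -/
theorem logDeriv_stieltjes_vertex [G.LocallyFinite] (hG : G.IsAcyclic)
    (hD : ∀ u, (G.neighborSet u).encard ≤ D) (hM : 0 ≤ M) (hz : 0 < z.im) (u : V)
    (p : G.edgeSet ⊕ V → ℝ) :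
    stieltjesDeriv (vertexMeasure G M u p) z / stieltjes (vertexMeasure G M u p) z =
      stieltjes (vertexMeasure G M u p) z + ∑ v : G.neighborSet u,
        (truncate M (p (.inl ⟨s(u, (v : V)), v.2⟩)) : ℂ) ^ 2 *
          stieltjesDeriv (cutMeasure G M ⟨s(u, (v : V)), v.2⟩ v p) z *
            stieltjes (vertexMeasure G M u p) z := by
  have hK : 0 ≤ M * (D + 1) := by positivity
  have hgu := isProbOn_vertexMeasure hD hM u p
  have hgu0 := hgu.stieltjes_ne_zero hK hz
  have hinv : (fun w => (stieltjes (vertexMeasure G M u p) w)⁻¹) =ᶠ[nhds z] fun w =>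
      truncate M (p (.inr u)) - w - ∑ v : G.neighborSet u,
        (truncate M (p (.inl ⟨s(u, (v : V)), v.2⟩)) : ℂ) ^ 2 *
          stieltjes (cutMeasure G M ⟨s(u, (v : V)), v.2⟩ v p) w := by
    filter_upwards [eventually_im_pos hz] with w hw
    exact inv_eq_of_mul_eq_one_right (stieltjes_vertex hG hD hM hw.ne' u p)
  have hsum : HasDerivAt (fun w => ∑ v : G.neighborSet u,
      (truncate M (p (.inl ⟨s(u, (v : V)), v.2⟩)) : ℂ) ^ 2 *
        stieltjes (cutMeasure G M ⟨s(u, (v : V)), v.2⟩ v p) w) (∑ v : G.neighborSet u,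
      (truncate M (p (.inl ⟨s(u, (v : V)), v.2⟩)) : ℂ) ^ 2 *
        stieltjesDeriv (cutMeasure G M ⟨s(u, (v : V)), v.2⟩ v p) z) z :=
    HasDerivAt.fun_sum fun v _ =>
      ((isProbOn_cutMeasure hD hM _ _ p).hasDerivAt_stieltjes hz).const_mul _
  have hder := (((hasDerivAt_id z).const_sub (truncate M (p (.inr u)) : ℂ)).sub hsum).unique
      (((hgu.hasDerivAt_stieltjes hz).inv hgu0).congr_of_eventuallyEq hinv.symm)
  rw [← Finset.sum_mul]
  generalize (∑ v : G.neighborSet u, (truncate M (p (.inl ⟨s(u, (v : V)), v.2⟩)) : ℂ) ^ 2 *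
    stieltjesDeriv (cutMeasure G M ⟨s(u, (v : V)), v.2⟩ v p) z) = Q at *
  field_simp at hder ⊢
  linear_combination hder

theorem stieltjesDeriv_congr {K : ℝ} {μ ν : Measure ℝ} (hμ : IsProbOn K μ) (hν : IsProbOn K ν)
    (h : ∀ w : ℂ, 0 < w.im → stieltjes μ w = stieltjes ν w) (hz : 0 < z.im) :
    stieltjesDeriv μ z = stieltjesDeriv ν z :=
  (hμ.hasDerivAt_stieltjes hz).unique ((hν.hasDerivAt_stieltjes hz).congr_of_eventuallyEq
    ((eventually_im_pos hz).mono h))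

/-- The relabelling of the parameters by a graph automorphism. -/
def relabel (σ : G ≃g G) (p : G.edgeSet ⊕ V → ℝ) : G.edgeSet ⊕ V → ℝ :=
  fun i => p (Sum.map σ.mapEdgeSet σ i)

theorem stieltjes_vertexMeasure_relabel (hD : ∀ u, (G.neighborSet u).encard ≤ D) (hM : 0 ≤ M)
    (σ : G ≃g G) (u : V) (p : G.edgeSet ⊕ V → ℝ) (hz : z.im ≠ 0) :
    stieltjes (vertexMeasure G M (σ u) p) z =
      stieltjes (vertexMeasure G M u (relabel σ p)) z := by
  rw [stieltjes_vertexMeasure hD hM _ _ hz, stieltjes_vertexMeasure hD hM _ _ hz,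
    greenFunction_iso σ hD hM (fun _ => abs_truncate_le hM _) (fun _ => abs_truncate_le hM _) hz]
  rfl

theorem stieltjes_cutMeasure_relabel (hD : ∀ u, (G.neighborSet u).encard ≤ D) (hM : 0 ≤ M)
    (σ : G ≃g G) (e : G.edgeSet) (v : V) (p : G.edgeSet ⊕ V → ℝ) (hz : z.im ≠ 0) :
    stieltjes (cutMeasure G M (σ.mapEdgeSet e) (σ v) p) z =
      stieltjes (cutMeasure G M e v (relabel σ p)) z := by
  rw [stieltjes_cutMeasure hD hM _ _ _ hz, stieltjes_cutMeasure hD hM _ _ _ hz,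
    greenFunction_iso σ hD hM (abs_removeEdge_le hM (fun _ => abs_truncate_le hM _) _)
      (fun _ => abs_truncate_le hM _) hz]
  congr 2
  funext f
  by_cases h : f = e
  · rw [h, removeEdge_self, removeEdge_self]
  · rw [removeEdge_of_ne _ h, removeEdge_of_ne _ (σ.mapEdgeSet.injective.ne h)]
    rfl

end Deterministic

end RandomOperator

/-! ### Invariance of the law of the parameters, and mixtures of measures. -/

section Law

/-- The joint law of an independent family is the product of its marginals. An injective reindexing
keeps independence, and here also the marginals, so the product is unchanged. -/
theorem measurePreserving_reindex {ι Ω : Type*} [MeasurableSpace Ω] {P : Measure Ω}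
    [IsProbabilityMeasure P] {X : ι → Ω → ℝ} (hX : ∀ i, Measurable (X i)) (hind : iIndepFun X P)
    {τ : ι → ι} (hτ : Function.Injective τ) (hid : ∀ i, IdentDistrib (X (τ i)) (X i) P P) :
    MeasurePreserving (fun (p : ι → ℝ) i => p (τ i)) (P.map fun ω i => X i ω)
      (P.map fun ω i => X i ω) := by
  have hm : Measurable fun (p : ι → ℝ) i => p (τ i) :=
    measurable_pi_lambda _ fun i => measurable_pi_apply _
  refine ⟨hm, ?_⟩
  rw [Measure.map_map hm (measurable_pi_lambda _ hX), hind.map_fun_eq_infinitePi_map hX]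
  refine ((hind.precomp hτ).map_fun_eq_infinitePi_map fun i => hX (τ i)).trans ?_
  congr 1
  funext i
  exact (hid i).map_eq

theorem integral_bind_measure {X E : Type*} [MeasurableSpace X] [NormedAddCommGroup E]
    [NormedSpace ℝ E] {ν : Measure X} {κ : X → Measure ℝ} (hκ : Measurable κ) {f : ℝ → E}
    (hf : Integrable f (ν.bind κ)) : ∫ t, f t ∂(ν.bind κ) = ∫ x, ∫ t, f t ∂(κ x) ∂ν := by
  have h := Kernel.integral_comp (κ := Kernel.const Unit ν) (η := (⟨κ, hκ⟩ : Kernel X ℝ))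
    (a := ()) (f := f)
  rw [Kernel.comp_apply, Kernel.const_apply] at h
  exact h hf

theorem isProbOn_bind {X : Type*} [MeasurableSpace X] {ν : Measure X} [IsProbabilityMeasure ν]
    {κ : X → Measure ℝ} (hκ : Measurable κ) {K : ℝ} (hprob : ∀ x, IsProbOn K (κ x)) :
    IsProbOn K (ν.bind κ) := by
  have := fun x => (hprob x).1
  constructor
  · refine ⟨?_⟩
    rw [Measure.bind_apply MeasurableSet.univ hκ.aemeasurable]
    simp
  · have hmeas : MeasurableSet {t : ℝ | |t| ≤ K}ᶜ :=
      (measurableSet_le measurable_norm measurable_const).compl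
    rw [ae_iff]
    change (ν.bind κ) {t : ℝ | |t| ≤ K}ᶜ = 0
    rw [Measure.bind_apply hmeas hκ.aemeasurable, lintegral_eq_zero_of_ae_eq_zero]
    exact Filter.Eventually.of_forall fun x => ae_iff.mp (hprob x).2

end Law

/-! ### The identity for automorphism-invariant laws. -/

section Homogeneous

variable {V : Type*} {G : SimpleGraph V} [G.LocallyFinite] {d : ℕ} {M : ℝ} {z : ℂ}
  {ν : Measure (G.edgeSet ⊕ V → ℝ)} [IsProbabilityMeasure ν]

theorem SimpleGraph.IsRegularOfDegree.encard_neighborSet_le (hreg : G.IsRegularOfDegree d)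
    (u : V) : (G.neighborSet u).encard ≤ d := by
  rw [← SimpleGraph.coe_neighborFinset, Set.encard_coe_eq_coe_finsetCard,
    SimpleGraph.card_neighborFinset_eq_degree, hreg u]

/-- The derivative of the logarithmic identity for the density of states. -/
theorem integral_stieltjes_add_logDeriv (hG : G.IsTree) (hreg : G.IsRegularOfDegree d)
    (hM : 0 ≤ M) (hd : 0 < d) (hν : ∀ σ : G ≃g G, MeasurePreserving (relabel σ) ν ν)
    (o u : V) {x y : V} (hxy : G.Adj x y) (hz : 0 < z.im) :
    ∫ p, stieltjes (vertexMeasure G M o p) z ∂ν +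
      ((d : ℂ) / 2 - 1) * ∫ p, stieltjesDeriv (vertexMeasure G M u p) z /
        stieltjes (vertexMeasure G M u p) z ∂ν +
      (-((d : ℂ) / 2)) * ∫ p, stieltjesDeriv (cutMeasure G M ⟨s(x, y), hxy⟩ y p) z /
        stieltjes (cutMeasure G M ⟨s(x, y), hxy⟩ y p) z ∂ν = 0 := by
  have hD := hreg.encard_neighborSet_le
  have hK : 0 ≤ M * (d + 1) := by positivity
  have hpg := fun u p => isProbOn_vertexMeasure (G := G) hD hM u p
  have hpm := fun e v p => isProbOn_cutMeasure (G := G) hD hM e v p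
  let g : V → (G.edgeSet ⊕ V → ℝ) → ℂ := fun u p => stieltjes (vertexMeasure G M u p) z
  let g' : V → (G.edgeSet ⊕ V → ℝ) → ℂ := fun u p => stieltjesDeriv (vertexMeasure G M u p) z
  let m : G.edgeSet → V → (G.edgeSet ⊕ V → ℝ) → ℂ :=
    fun e v p => stieltjes (cutMeasure G M e v p) z
  let m' : G.edgeSet → V → (G.edgeSet ⊕ V → ℝ) → ℂ :=
    fun e v p => stieltjesDeriv (cutMeasure G M e v p) z
  let α : G.edgeSet → (G.edgeSet ⊕ V → ℝ) → ℂ := fun e p => (truncate M (p (.inl e)) : ℂ) ^ 2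
  have hgm : ∀ u, Measurable (g u) := fun u =>
    measurable_stieltjes (measurable_vertexMeasure hD hM u) hz.ne'
  have hgm' : ∀ u, Measurable (g' u) := fun u =>
    measurable_stieltjesDeriv (measurable_vertexMeasure hD hM u) hz.ne'
  have hmm : ∀ e v, Measurable (m e v) := fun e v =>
    measurable_stieltjes (measurable_cutMeasure hD hM e v) hz.ne'
  have hmm' : ∀ e v, Measurable (m' e v) := fun e v =>
    measurable_stieltjesDeriv (measurable_cutMeasure hD hM e v) hz.ne'
  have hαm : ∀ e, Measurable (α e) := fun e => (Complex.measurable_ofReal.comp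
    ((measurable_truncate M).comp (measurable_pi_apply _))).pow_const 2
  have hg_int : ∀ u, Integrable (g u) ν := fun u =>
    Integrable.of_bound (hgm u).aestronglyMeasurable _
      (Filter.Eventually.of_forall fun p => (hpg u p).norm_stieltjes_le hz)
  have hlg_int : ∀ u, Integrable (fun p => g' u p / g u p) ν := fun u =>
    Integrable.of_bound ((hgm' u).div (hgm u)).aestronglyMeasurable _
      (Filter.Eventually.of_forall fun p => norm_logDeriv_stieltjes_le (half_pos hz) hK
        (half_lt_self hz) (lt_add_one ‖z‖) (hpg u p))
  have hlm_int : ∀ e v, Integrable (fun p => m' e v p / m e v p) ν := fun e v =>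
    Integrable.of_bound ((hmm' e v).div (hmm e v)).aestronglyMeasurable _
      (Filter.Eventually.of_forall fun p => norm_logDeriv_stieltjes_le (half_pos hz) hK
        (half_lt_self hz) (lt_add_one ‖z‖) (hpm e v p))
  have hq_meas : ∀ e v u, Measurable fun p => α e p * m' e v p * g u p := fun e v u =>
    ((hαm e).mul (hmm' e v)).mul (hgm u)
  have hq_int : ∀ e v u, Integrable (fun p => α e p * m' e v p * g u p) ν := fun e v u => by
    refine Integrable.of_bound (hq_meas e v u).aestronglyMeasurable (M ^ 2 * (z.im⁻¹) ^ 2 * z.im⁻¹)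
      (Filter.Eventually.of_forall fun p => ?_)
    rw [norm_mul, norm_mul, norm_pow, Complex.norm_real]
    have h1 : ‖truncate M (p (.inl e))‖ ^ 2 ≤ M ^ 2 :=
      pow_le_pow_left₀ (norm_nonneg _) (abs_truncate_le hM _) 2
    have h2 := (hpm e v p).norm_stieltjesDeriv_le hz
    have h3 := (hpg u p).norm_stieltjes_le hz
    have h4 : 0 ≤ z.im⁻¹ := inv_nonneg.mpr hz.le
    exact mul_le_mul (mul_le_mul h1 h2 (norm_nonneg _) (by positivity)) h3 (norm_nonneg _)
      (by positivity)
  have hcov_g : ∀ (σ : G ≃g G) u p, g (σ u) p = g u (relabel σ p) := fun σ u p =>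
    stieltjes_vertexMeasure_relabel hD hM σ u p hz.ne'
  have hcov_g' : ∀ (σ : G ≃g G) u p, g' (σ u) p = g' u (relabel σ p) := fun σ u p =>
    stieltjesDeriv_congr (hpg _ _) (hpg _ _)
      (fun w hw => stieltjes_vertexMeasure_relabel hD hM σ u p hw.ne') hz
  have hcov_m : ∀ (σ : G ≃g G) e v p, m (σ.mapEdgeSet e) (σ v) p = m e v (relabel σ p) :=
    fun σ e v p => stieltjes_cutMeasure_relabel hD hM σ e v p hz.ne'
  have hcov_m' : ∀ (σ : G ≃g G) e v p, m' (σ.mapEdgeSet e) (σ v) p = m' e v (relabel σ p) :=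
    fun σ e v p => stieltjesDeriv_congr (hpm _ _ _) (hpm _ _ _)
      (fun w hw => stieltjes_cutMeasure_relabel hD hM σ e v p hw.ne') hz
  have hint : ∀ (σ : G ≃g G) {F F' : (G.edgeSet ⊕ V → ℝ) → ℂ}, Measurable F →
      (∀ p, F' p = F (relabel σ p)) → ∫ p, F' p ∂ν = ∫ p, F p ∂ν := by
    intro σ F F' hF hFF'
    rw [integral_congr_ae (Filter.Eventually.of_forall hFF')]
    have := integral_map (μ := ν) (hν σ).measurable.aemeasurable (f := F) hF.aestronglyMeasurable
    rw [(hν σ).map_eq] at this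
    exact this.symm
  -- Since `d > 0`, every vertex is the tail of a dart, so transitivity on darts gives transitivity
  -- on vertices.
  have hvert : ∀ v w : V, ∃ σ : G ≃g G, σ v = w := by
    have hnb : ∀ v : V, ∃ w, G.Adj v w := fun v =>
      (G.degree_pos_iff_exists_adj v).mp (by rw [hreg v]; exact hd)
    intro v w
    obtain ⟨v', hv'⟩ := hnb v
    obtain ⟨w', hw'⟩ := hnb w
    obtain ⟨σ, hσ, -⟩ := hG.exists_iso_dart hreg hv' hw'
    exact ⟨σ, hσ⟩
  have hE0 : ∫ p, g o p ∂ν = ∫ p, g u p ∂ν := by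
    obtain ⟨σ, rfl⟩ := hvert u o
    exact hint σ (hgm u) fun p => hcov_g σ u p
  have hE1 : ∫ p, g' u p / g u p ∂ν = ∫ p, g' x p / g x p ∂ν := by
    obtain ⟨σ, rfl⟩ := hvert x u
    exact hint σ ((hgm' x).div (hgm x)) fun p => by
      rw [hcov_g, hcov_g']
  -- An automorphism reversing the edge `xy` fixes it as an undirected edge and exchanges its two
  -- m-functions.
  have hE2 : ∫ p, m' ⟨s(x, y), hxy⟩ x p / m ⟨s(x, y), hxy⟩ x p ∂ν =
      ∫ p, m' ⟨s(x, y), hxy⟩ y p / m ⟨s(x, y), hxy⟩ y p ∂ν := by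
    obtain ⟨σ, hσ1, hσ2⟩ := hG.exists_iso_dart hreg hxy hxy.symm
    have he : σ.mapEdgeSet ⟨s(x, y), hxy⟩ = ⟨s(x, y), hxy⟩ := by
      apply Subtype.ext
      change s(σ x, σ y) = s(x, y)
      rw [hσ1, hσ2, Sym2.eq_swap]
    refine hint σ ((hmm' _ y).div (hmm _ y)) fun p => ?_
    rw [← hcov_m, ← hcov_m', he, hσ2]
  have hQ : ∀ (v w : V) (h : G.Adj v w),
      ∫ p, α ⟨s(v, w), h⟩ p * m' ⟨s(v, w), h⟩ w p * g v p ∂ν =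
        ∫ p, α ⟨s(x, y), hxy⟩ p * m' ⟨s(x, y), hxy⟩ y p * g x p ∂ν := by
    intro v w h
    obtain ⟨σ, rfl, rfl⟩ := hG.exists_iso_dart hreg hxy h
    refine hint σ (hq_meas _ y x) fun p => ?_
    rw [← hcov_m', ← hcov_g]
    rfl
  have hE0' : ∫ p, g u p ∂ν = ∫ p, g x p ∂ν := by
    obtain ⟨σ, rfl⟩ := hvert x u
    exact hint σ (hgm x) fun p => hcov_g σ x p
  set Q := ∫ p, α ⟨s(x, y), hxy⟩ p * m' ⟨s(x, y), hxy⟩ y p * g x p ∂ν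
  have hV : ∫ p, g' x p / g x p ∂ν = ∫ p, g x p ∂ν + d * Q := by
    rw [integral_congr_ae (Filter.Eventually.of_forall fun p =>
      logDeriv_stieltjes_vertex hG.isAcyclic hD hM hz x p),
      integral_add (hg_int x) (integrable_finsetSum _ fun v _ => hq_int _ _ _),
      integral_finsetSum _ fun v _ => hq_int _ _ _,
      Finset.sum_congr rfl fun (v : G.neighborSet x) _ => hQ x v v.2, Finset.sum_const, Finset.card_univ,
      SimpleGraph.card_neighborSet_eq_degree, hreg x, nsmul_eq_mul]
  have hEdge : ∫ p, g' x p / g x p ∂ν - ∫ p, m' ⟨s(x, y), hxy⟩ x p / m ⟨s(x, y), hxy⟩ x p ∂ν =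
      Q + Q := by
    have hswap : (⟨s(y, x), hxy.symm⟩ : G.edgeSet) = ⟨s(x, y), hxy⟩ := Subtype.ext Sym2.eq_swap
    have hQ' := hQ y x hxy.symm
    rw [hswap] at hQ'
    rw [← integral_sub (hlg_int x) (hlm_int _ x),
      integral_congr_ae (Filter.Eventually.of_forall fun p =>
      logDeriv_stieltjes_edge hG.isAcyclic hD hM hz ⟨s(x, y), hxy⟩ rfl p),
      integral_add (hq_int _ _ _) (hq_int _ _ _)]
    exact congrArg₂ (· + ·) rfl hQ'
  change ∫ p, g o p ∂ν + ((d : ℂ) / 2 - 1) * ∫ p, g' u p / g u p ∂ν +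
    (-((d : ℂ) / 2)) * ∫ p, m' ⟨s(x, y), hxy⟩ y p / m ⟨s(x, y), hxy⟩ y p ∂ν = 0
  rw [hE0, hE0', hE1, ← hE2]
  -- The coefficient `d/2` matches the `d` copies of `Q` at a vertex with the two at an edge.
  linear_combination ((d : ℂ) / 2) * hEdge - hV

/-- The logarithmic identity for the density of states of a homogeneous random operator. -/
theorem integral_log_densityOfStates (hG : G.IsTree) (hreg : G.IsRegularOfDegree d)
    (hM : 0 ≤ M) (hd : 0 < d) (hν : ∀ σ : G ≃g G, MeasurePreserving (relabel σ) ν ν)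
    (o u : V) {x y : V} (hxy : G.Adj x y) (hz : 0 < z.im) :
    Integrable (fun t : ℝ => Complex.log ((t : ℂ) - z)) (ν.bind (vertexMeasure G M o)) ∧
    ∫ t : ℝ, Complex.log ((t : ℂ) - z) ∂(ν.bind (vertexMeasure G M o)) =
      ((d : ℂ) / 2 - 1) * ∫ p, Complex.log (stieltjes (vertexMeasure G M u p) z) ∂ν -
        (d : ℂ) / 2 *
          ∫ p, Complex.log (stieltjes (cutMeasure G M ⟨s(x, y), hxy⟩ y p) z) ∂ν := by
  have hD := hreg.encard_neighborSet_le
  have hK : 0 ≤ M * (d + 1) := by positivity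
  have hgm := fun u => measurable_vertexMeasure (G := G) hD hM u
  have hmm := fun e v => measurable_cutMeasure (G := G) hD hM e v
  have hpg := fun u => Filter.Eventually.of_forall (f := ae ν)
    fun p => isProbOn_vertexMeasure (G := G) hD hM u p
  have hpm := fun e v => Filter.Eventually.of_forall (f := ae ν)
    fun p => isProbOn_cutMeasure (G := G) hD hM e v p
  have hdk : IsProbOn (M * (d + 1)) (ν.bind (vertexMeasure G M o)) :=
    isProbOn_bind (hgm o) fun p => isProbOn_vertexMeasure hD hM o p
  have := hdk.1
  -- From here on `t ↦ δ_t` under `dk` is treated as a third random measure, beside the vertex and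
  -- cut measures.
  have hdirac : ∀ᵐ t ∂(ν.bind (vertexMeasure G M o)), IsProbOn (M * (d + 1)) (Measure.dirac t) :=
    hdk.2.mono fun t ht => isProbOn_dirac ht
  have hlog : (fun t : ℝ => Complex.log ((t : ℂ) - z)) =
      fun t => -Complex.log (stieltjes (Measure.dirac t) z) :=
    funext fun t => log_ofReal_sub_eq hz t
  rw [hlog]
  refine ⟨(integrable_log_stieltjes Measure.measurable_dirac hK hdirac hz).neg, ?_⟩
  -- With `K = M * (d + 1)`, a single constant `2 K` must serve both as threshold for `y` and as
  -- error bound; the threshold forces `2`, so the error constant `3/2` is weakened.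
  have hB : ∀ {y : ℝ} {w : ℂ}, 0 < y → ‖w‖ ≤ 3 / 2 * (M * (d + 1)) / y →
      ‖w‖ ≤ 2 * (M * (d + 1)) / y := fun hy h =>
    h.trans (div_le_div_of_nonneg_right (mul_le_mul_of_nonneg_right (by norm_num) hK) hy.le)
  have key := linearCombination_eq_zero_of_deriv (z := z) (B := 2 * (M * (d + 1)))
    (α := 1) (β := (d : ℂ) / 2 - 1) (γ := -((d : ℂ) / 2))
    (fun w hw => hasDerivAt_integral_log_stieltjes Measure.measurable_dirac hK hdirac hw)
    (fun w hw => hasDerivAt_integral_log_stieltjes (hgm u) hK (hpg u) hw)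
    (fun w hw => hasDerivAt_integral_log_stieltjes (hmm ⟨s(x, y), hxy⟩ y) hK (hpm _ y) hw)
    (fun t ht htB => hB ht
      (norm_integral_log_stieltjes_add_log_le Measure.measurable_dirac hK hdirac ht htB))
    (fun t ht htB => hB ht
      (norm_integral_log_stieltjes_add_log_le (hgm u) hK (hpg u) ht htB))
    (fun t ht htB => hB ht
      (norm_integral_log_stieltjes_add_log_le (hmm _ y) hK (hpm _ y) ht htB))
    (by ring)
    (fun w hw => by
      rw [one_mul]
      refine Eq.trans ?_ (integral_stieltjes_add_logDeriv hG hreg hM hd hν o u hxy hw)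
      congr 2
      -- For a Dirac mass the logarithmic derivative is the Stieltjes kernel itself, whose
      -- `dk`-integral is the expected Green's function at `o`.
      have hdiv : ∀ t : ℝ, stieltjesDeriv (Measure.dirac t) w / stieltjes (Measure.dirac t) w =
          ((t : ℂ) - w)⁻¹ := fun t => by
        rw [stieltjes_dirac, stieltjesDeriv_dirac, pow_two, mul_div_assoc,
          div_self (inv_ne_zero (ofReal_sub_ne_zero hw.ne' t)), mul_one]
      simp_rw [hdiv]
      exact integral_bind_measure (hgm o) (hdk.integrable_inv hw))
    hz
  rw [integral_neg]
  linear_combination -key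

end Homogeneous

/-! ### Transfer to the given probability space. -/

theorem mainTheorem4 {V Ω : Type*} [MeasurableSpace Ω] (P : Measure Ω) [IsProbabilityMeasure P]
    (d : ℕ) (hd : 0 < d) (G : SimpleGraph V) [G.LocallyFinite]
    (hG : G.IsTree) (hreg : G.IsRegularOfDegree d)
    (a : G.edgeSet → Ω → ℝ) (b : V → Ω → ℝ)
    (ha_meas : ∀ e, Measurable (a e)) (hb_meas : ∀ v, Measurable (b v))
    (hindep : iIndepFun (Sum.elim a b : G.edgeSet ⊕ V → Ω → ℝ) P)
    (ha_ident : ∀ e e', IdentDistrib (a e) (a e') P P)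
    (hb_ident : ∀ v v', IdentDistrib (b v) (b v') P P)
    (C : ℝ) (ha_bdd : ∀ e, ∀ᵐ ω ∂P, |a e ω| ≤ C) (hb_bdd : ∀ v, ∀ᵐ ω ∂P, |b v ω| ≤ C)
    (o u : V) (e : G.Dart) (z : ℂ) (hz : 0 < z.im) :
    AEMeasurable (fun ω => spectralMeasure (andersonOperator G a b ω) (deltaVec o)) P ∧
    IsProbabilityMeasure (densityOfStates P G a b o) ∧
    Integrable (fun t : ℝ => Complex.log ((t : ℂ) - z)) (densityOfStates P G a b o) ∧
    Integrable (fun ω => Complex.log (greenFunction (andersonOperator G a b ω) u z)) P ∧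
    Integrable
      (fun ω => Complex.log (mFunction G (fun f => a f ω) (fun v => b v ω) e z)) P ∧
    ∫ t : ℝ, Complex.log ((t : ℂ) - z) ∂(densityOfStates P G a b o) =
      ((d : ℂ) / 2 - 1) * ∫ ω, Complex.log (greenFunction (andersonOperator G a b ω) u z) ∂P
        - ((d : ℂ) / 2) *
          ∫ ω, Complex.log (mFunction G (fun f => a f ω) (fun v => b v ω) e z) ∂P ∧
    (d = 2 → ∫ t : ℝ, Complex.log ((t : ℂ) - z) ∂(densityOfStates P G a b o) =
      -∫ ω, Complex.log (mFunction G (fun f => a f ω) (fun v => b v ω) e z) ∂P) := by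
  have hD := hreg.encard_neighborSet_le
  -- The truncation level is `|C|`, since no sign is assumed for `C`.
  have hM : 0 ≤ |C| := abs_nonneg C
  have hK : 0 ≤ |C| * (d + 1) := by positivity
  have : Countable V := hG.connected.countable_of_locallyFinite
  have : Countable G.edgeSet := Subtype.countable
  have hX : ∀ i, Measurable ((Sum.elim a b : G.edgeSet ⊕ V → Ω → ℝ) i) := by
    rintro (f | v)
    · exact ha_meas f
    · exact hb_meas v
  let Y : Ω → G.edgeSet ⊕ V → ℝ := fun ω i => (Sum.elim a b : G.edgeSet ⊕ V → Ω → ℝ) i ω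
  have hY : Measurable Y := measurable_pi_lambda _ hX
  have hν : ∀ σ : G ≃g G, MeasurePreserving (relabel σ) (P.map Y) (P.map Y) := by
    intro σ
    refine measurePreserving_reindex hX hindep
      (Function.Injective.sumMap σ.mapEdgeSet.injective σ.injective) ?_
    rintro (f | v)
    · exact ha_ident _ _
    · exact hb_ident _ _
  have : IsProbabilityMeasure (P.map Y) := Measure.isProbabilityMeasure_map hY.aemeasurable
  have hbdd : ∀ᵐ ω ∂P, (∀ f, |a f ω| ≤ |C|) ∧ ∀ v, |b v ω| ≤ |C| := by
    refine Filter.Eventually.and (ae_all_iff.mpr fun f => ?_) (ae_all_iff.mpr fun v => ?_)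
    · exact (ha_bdd f).mono fun ω h => h.trans (le_abs_self C)
    · exact (hb_bdd v).mono fun ω h => h.trans (le_abs_self C)
  have hparam : ∀ ω, (∀ f, |a f ω| ≤ |C|) → (∀ v, |b v ω| ≤ |C|) →
      ((fun f => truncate |C| (Y ω (.inl f))) = fun f => a f ω) ∧
        ((fun v => truncate |C| (Y ω (.inr v))) = fun v => b v ω) := fun ω h1 h2 =>
    ⟨funext fun f => truncate_eq (h1 f), funext fun v => truncate_eq (h2 v)⟩
  -- Off a null set truncation changes nothing. On that set `jacobiOperator` may take its default
  -- value, so only almost everywhere measurability of the original spectral measure is obtained.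
  have hspec : ∀ v, (fun ω => spectralMeasure (andersonOperator G a b ω) (deltaVec v)) =ᵐ[P]
      fun ω => vertexMeasure G |C| v (Y ω) := by
    intro v
    filter_upwards [hbdd] with ω hω
    obtain ⟨h1, h2⟩ := hparam ω hω.1 hω.2
    rw [vertexMeasure, h1, h2]
    rfl
  have hgreen : (fun ω => Complex.log (greenFunction (andersonOperator G a b ω) u z)) =ᵐ[P]
      fun ω => Complex.log (stieltjes (vertexMeasure G |C| u (Y ω)) z) := by
    filter_upwards [hbdd] with ω hω
    obtain ⟨h1, h2⟩ := hparam ω hω.1 hω.2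
    rw [stieltjes_vertexMeasure hD hM _ _ hz.ne', h1, h2]
    rfl
  obtain ⟨⟨x, y⟩, hxy⟩ := e
  have hm : (fun ω => Complex.log (mFunction G (fun f => a f ω) (fun v => b v ω)
      ⟨(x, y), hxy⟩ z)) =ᵐ[P]
        fun ω => Complex.log (stieltjes (cutMeasure G |C| ⟨s(x, y), hxy⟩ y (Y ω)) z) := by
    filter_upwards [hbdd] with ω hω
    obtain ⟨h1, h2⟩ := hparam ω hω.1 hω.2
    rw [(greenVec_removeEdge hG.isAcyclic hD hM hω.1 hω.2 hz.ne' ⟨(x, y), hxy⟩).1,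
      stieltjes_cutMeasure hD hM _ _ _ hz.ne', h1, h2]
    rfl
  have hvm := fun v => measurable_vertexMeasure (G := G) hD hM v
  have hcm := fun f v => measurable_cutMeasure (G := G) hD hM f v
  have hdos : densityOfStates P G a b o = (P.map Y).bind (vertexMeasure G |C| o) := by
    rw [densityOfStates, Measure.bind_congr_right (hspec o), Measure.bind, Measure.bind,
      Measure.map_map (hvm o) hY]
    rfl
  have hg_int := integrable_log_stieltjes (ν := P) ((hvm u).comp hY) hK
    (Filter.Eventually.of_forall fun ω => isProbOn_vertexMeasure hD hM u (Y ω)) hz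
  have hm_int := integrable_log_stieltjes (ν := P) ((hcm ⟨s(x, y), hxy⟩ y).comp hY) hK
    (Filter.Eventually.of_forall fun ω => isProbOn_cutMeasure hD hM _ y (Y ω)) hz
  have hI₁ : ∫ p, Complex.log (stieltjes (vertexMeasure G |C| u p) z) ∂(P.map Y) =
      ∫ ω, Complex.log (greenFunction (andersonOperator G a b ω) u z) ∂P :=
    (integral_map hY.aemeasurable (Complex.measurable_log.comp
      (measurable_stieltjes (hvm u) hz.ne')).aestronglyMeasurable).trans
        (integral_congr_ae hgreen).symm
  have hI₂ : ∫ p, Complex.log (stieltjes (cutMeasure G |C| ⟨s(x, y), hxy⟩ y p) z) ∂(P.map Y) =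
      ∫ ω, Complex.log (mFunction G (fun f => a f ω) (fun v => b v ω) ⟨(x, y), hxy⟩ z) ∂P :=
    (integral_map hY.aemeasurable (Complex.measurable_log.comp
      (measurable_stieltjes (hcm _ y) hz.ne')).aestronglyMeasurable).trans
        (integral_congr_ae hm).symm
  obtain ⟨hlog, hmain⟩ := integral_log_densityOfStates hG hreg hM hd hν o u
    (show G.Adj x y from hxy) hz
  rw [hI₁, hI₂, ← hdos] at hmain
  refine ⟨((hvm o).comp hY).aemeasurable.congr (hspec o).symm, ?_, ?_, hg_int.congr hgreen.symm,
    hm_int.congr hm.symm, hmain, fun h2 => ?_⟩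
  · rw [hdos]
    exact (isProbOn_bind (hvm o) fun p => isProbOn_vertexMeasure hD hM o p).1
  · rw [hdos]
    exact hlog
  · rw [hmain, h2]
    norm_num
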